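/- Let $\mathcal C_f\subset(0,1)$ be a finite set and let $f:[0,1]\setminus\mathcal C_f\to[0,1]$ be a $C^3$ local diffeomorphism with negative Schwarzian derivative, i.e. $f'\ne0$ and $\frac{f'''}{f'}-\frac32\big(\frac{f''}{f'}\big)^2<0$ on $[0,1]\setminus\mathcal C_f$ (one-sided derivatives at $0$ and $1$). For $x\in[0,1]$ let $\omega_f(x)$ be the set of accumulation points of the sequence $(f^n(x))_{n\ge0}$ if this orbit never meets $\mathcal C_f$, and $\omega_f(x)=\emptyset$ otherwise. Write $p-\mathrm i$ for the left side of a point $p\in(0,1]$ and $p+\mathrm i$ for the right side of a point $p\in[0,1)$, and let $f$ act on these lateral points, viewed as complex numbers, by $$f(p-\mathrm i)=\lim_{x\uparrow p}f(x)-\mathrm i\lim_{x\uparrow p}\frac{f'(x)}{|f'(x)|},\qquad f(p+\mathrm i)=\lim_{x\downarrow p}f(x)+\mathrm i\lim_{x\downarrow p}\frac{f'(x)}{|f'(x)|}.$$ Let $\mathcal O_f^+(\alpha)=\{f^n(\alpha):n\ge0\}$ for a lateral point $\alpha$, and let $\mathbb C_f=\{c-\mathrm i,\,c+\mathrm i:\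 c\in\mathcal C_f\}$ be the lateral exceptional set. For $A\subset[0,1]$ put $\beta_f(A)=\{x\in[0,1]:\omega_f(x)\subset A\}$. A compact set $A\subset[0,1]$ is an attractor if $\beta_f(A)$ has positive Lebesgue measure and no closed set $A'\subsetneq A$ has $\beta_f(A')=\beta_f(A)$ up to a null set. A periodic-like attractor is an attractor of the form $A=\mathrm{Re}(\mathcal O_f^+(\alpha))$ with $\alpha$ a lateral point such that $f^n(\alpha)=\alpha$ for some $n\ge1$. Let $\mathbb B_0(f)$ be the union of the basins $\beta_f(A)$ of all periodic-like attractors $A$, and let $\mathbb B_1(f)$ be the set of $x\in[0,1]$ such that $\omega_f(x)$ has non-empty interior (equivalently, $\omega_f(x)$ is a cycle of intervals). Then for Lebesgue almost every $x\in[0,1]\setminus(\mathbb B_0(f)\cup\mathbb B_1(f))$, $$\omega_f(x)\subset\bigcup_{\alpha\in\mathbb C_f}\overline{\mathrm{Re}(\mathcal O_f^+(\alpha))}.$$ -/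

import Mathlib

open Set Filter Topology MeasureTheory

noncomputable section

/-- The Schwarzian derivative of `f` at `x`, derivatives being taken within `s`
(one-sided at the end points of an interval). -/
def schwarzianWithin (f : ℝ → ℝ) (s : Set ℝ) (x : ℝ) : ℝ :=
  iteratedDerivWithin 3 f s x / derivWithin f s x
    - 3 / 2 * (iteratedDerivWithin 2 f s x / derivWithin f s x) ^ 2

/-- `f : [0,1] ∖ C → [0,1]` is a `C³` local diffeomorphism with negative Schwarzian derivative,
where the exceptional set `C ⊆ (0,1)` is finite. The values of `f` on `C` and outside `[0,1]`
are irrelevant. -/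
structure IsPiecewiseNegSchwarzian (f : ℝ → ℝ) (C : Set ℝ) : Prop where
  finite : C.Finite
  subset_Ioo : C ⊆ Ioo 0 1
  mapsTo : MapsTo f (Icc 0 1 \ C) (Icc 0 1)
  contDiffOn : ContDiffOn ℝ 3 f (Icc 0 1 \ C)
  deriv_ne_zero : ∀ x ∈ Icc (0 : ℝ) 1 \ C, derivWithin f (Icc 0 1 \ C) x ≠ 0
  schwarzian_neg : ∀ x ∈ Icc (0 : ℝ) 1 \ C, schwarzianWithin f (Icc 0 1 \ C) x < 0

/-- The pre-orbit of the exceptional set: the points whose orbit hits `C`. -/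
def preorbit (f : ℝ → ℝ) (C : Set ℝ) : Set ℝ := {x | ∃ j : ℕ, f^[j] x ∈ C}

/-- The omega limit set of `x`: the accumulation points of the sequence `fⁿ(x)`.
The orbit of a point of the pre-orbit of `C` stops at `C`, and its omega limit set is empty. -/
def omegaSet (f : ℝ → ℝ) (C : Set ℝ) (x : ℝ) : Set ℝ :=
  {y | x ∉ preorbit f C ∧ MapClusterPt y atTop (fun n : ℕ => f^[n] x)}

/-- The basin of attraction of `A`. -/
def attractionBasin (f : ℝ → ℝ) (C A : Set ℝ) : Set ℝ :=
  {x | x ∈ Icc (0 : ℝ) 1 ∧ omegaSet f C x ⊆ A}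

/-- Metrical attractors in the sense of Milnor. -/
structure IsMetricalAttractor (f : ℝ → ℝ) (C A : Set ℝ) : Prop where
  isCompact : IsCompact A
  subset_Icc : A ⊆ Icc 0 1
  basin_pos : 0 < volume (attractionBasin f C A)
  minimal : ∀ A' : Set ℝ, IsClosed A' → A' ⊂ A →
    ¬ (attractionBasin f C A' =ᵐ[volume] attractionBasin f C A)

/-- The map induced by `f` on lateral points, where `p - i` and `p + i` stand for the left and
the right side of `p`:
`f(p - i) = lim_{x ↑ p} f(x) - i lim_{x ↑ p} f'(x)/|f'(x)|` and
`f(p + i) = lim_{x ↓ p} f(x) + i lim_{x ↓ p} f'(x)/|f'(x)|`. -/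
def lateralStep (f : ℝ → ℝ) (α : ℂ) : ℂ :=
  if α.im < 0 then
    ((Function.leftLim f α.re : ℝ) : ℂ)
      - Complex.I * ((Function.leftLim (fun x : ℝ => deriv f x / |deriv f x|) α.re : ℝ) : ℂ)
  else
    ((Function.rightLim f α.re : ℝ) : ℂ)
      + Complex.I * ((Function.rightLim (fun x : ℝ => deriv f x / |deriv f x|) α.re : ℝ) : ℂ)

/-- The forward orbit of a lateral point. -/
def lateralOrbit (f : ℝ → ℝ) (α : ℂ) : Set ℂ := {β | ∃ n : ℕ, β = (lateralStep f)^[n] α}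

/-- The lateral points `p - i`, `p + i` of `[0,1]`: there is no left side of `0` and no right side
of `1` in `[0,1]`. -/
def lateralPoints : Set ℂ :=
  {α | ∃ p ∈ Ioc (0 : ℝ) 1, α = (p : ℂ) - Complex.I} ∪
    {α | ∃ p ∈ Ico (0 : ℝ) 1, α = (p : ℂ) + Complex.I}

/-- The lateral exceptional set `{c - i, c + i : c ∈ C}`. -/
def lateralExceptionalSet (C : Set ℝ) : Set ℂ :=
  {α | ∃ c ∈ C, α = (c : ℂ) - Complex.I} ∪ {α | ∃ c ∈ C, α = (c : ℂ) + Complex.I}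

/-- `A` is a periodic-like orbit: the real part of the orbit of a lateral point `p ± i` with
`fⁿ(p ± i) = p ± i` for some `n ≥ 1`. -/
def IsPeriodicLikeOrbit (f : ℝ → ℝ) (A : Set ℝ) : Prop :=
  ∃ α ∈ lateralPoints, (∃ n : ℕ, 1 ≤ n ∧ (lateralStep f)^[n] α = α) ∧
    A = Complex.re '' lateralOrbit f α

/-- `𝔹₀(f)`: the union of the basins of attraction of the periodic-like attractors. -/
def periodicLikeBasins (f : ℝ → ℝ) (C : Set ℝ) : Set ℝ :=
  {x | ∃ A : Set ℝ, IsMetricalAttractor f C A ∧ IsPeriodicLikeOrbit f A ∧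
    x ∈ attractionBasin f C A}

/-- `𝔹₁(f)`: the points of `[0,1]` whose omega limit set has non-empty interior
(equivalently, is a cycle of intervals). -/
def intervalCycleBasins (f : ℝ → ℝ) (C : Set ℝ) : Set ℝ :=
  {x | x ∈ Icc (0 : ℝ) 1 ∧ (interior (omegaSet f C x)).Nonempty}

end

/-! Let V be `postcriticalClosure f C`, a closed set, and suppose that the orbit of x accumulates at
some p outside V. An end inside (0,1) of a component of the domain of `f^[n]` hits C before time n
and from then on follows a lateral exceptional orbit, so the branch has its one-sided limit there in
V. A branch with both ends in (0,1) therefore covers every interval off V that its image meets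
(`exists_Icc_subset_image`), and the Koebe principle for negative Schwarzian derivative bounds its
distortion over a smaller interval, uniformly in n (`exists_bounded_distortion`).

Points whose orbit hits C have empty omega limit set. For the others there are two cases, according
to whether x is interior to the set of points that never hit C (`survivorSet`).

If x is not interior then, outside a countable set, the domains of the iterates shrink to x. Returns
to a window around p pull any gap in that window back to a definite proportion of arbitrarily small
neighbourhoods of x, so by Lebesgue density almost no such orbit eventually avoids the gap
(`volume_avoiding_eq_zero`). Hence the omega limit set contains the window, and x lies in 𝔹₁.

If x is interior, bounded distortion gives the images of a neighbourhood of x a definite size at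
late returns near p, so two iterates share a component of the interior (`exists_uIcc_subset`). Some
`f^[m]` maps that component increasingly into itself, and the orbit converges monotonically to a
periodic lateral point that attracts an interval. Thus x lies in 𝔹₀
(`mem_periodicLikeBasins_of_uIcc_subset`), unless it is preperiodic, which happens for countably
many x only (`countable_preperiodic`). -/

/-! ### Negative Schwarzian derivative and the Koebe principle -/

/-- `h1`, `h2`, `h3` are the first three derivatives of `h` on `S`, where `h1` does not vanish and
the Schwarzian derivative of `h` is negative. -/
structure NegSchwarzianOn (h h1 h2 h3 : ℝ → ℝ) (S : Set ℝ) : Prop where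
  hasDerivAt : ∀ x ∈ S, HasDerivAt h (h1 x) x
  hasDerivAt_one : ∀ x ∈ S, HasDerivAt h1 (h2 x) x
  hasDerivAt_two : ∀ x ∈ S, HasDerivAt h2 (h3 x) x
  ne_zero : ∀ x ∈ S, h1 x ≠ 0
  neg : ∀ x ∈ S, 2 * h3 x * h1 x < 3 * h2 x ^ 2

namespace NegSchwarzianOn

variable {h h1 h2 h3 g g1 g2 g3 : ℝ → ℝ} {S T : Set ℝ}

theorem mono (H : NegSchwarzianOn h h1 h2 h3 S) (hTS : T ⊆ S) : NegSchwarzianOn h h1 h2 h3 T :=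
  ⟨fun x hx => H.1 x (hTS hx), fun x hx => H.2 x (hTS hx), fun x hx => H.3 x (hTS hx),
    fun x hx => H.4 x (hTS hx), fun x hx => H.5 x (hTS hx)⟩

theorem neg_fun (H : NegSchwarzianOn h h1 h2 h3 S) :
    NegSchwarzianOn (fun x => -h x) (fun x => -h1 x) (fun x => -h2 x) (fun x => -h3 x) S :=
  ⟨fun x hx => (H.1 x hx).fun_neg, fun x hx => (H.2 x hx).fun_neg,
    fun x hx => (H.3 x hx).fun_neg,
    fun x hx => neg_ne_zero.2 (H.4 x hx), fun x hx => by have := H.5 x hx; nlinarith⟩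

theorem continuousOn (H : NegSchwarzianOn h h1 h2 h3 S) : ContinuousOn h S :=
  fun x hx => (H.1 x hx).continuousAt.continuousWithinAt

/-- The Schwarzian derivative of a composition of maps with negative Schwarzian derivative is
negative. -/
theorem comp (H : NegSchwarzianOn h h1 h2 h3 T) (G : NegSchwarzianOn g g1 g2 g3 S)
    (hm : MapsTo g S T) :
    NegSchwarzianOn (fun x => h (g x)) (fun x => h1 (g x) * g1 x)
      (fun x => h2 (g x) * g1 x ^ 2 + h1 (g x) * g2 x)
      (fun x => h3 (g x) * g1 x ^ 3 + 3 * h2 (g x) * g1 x * g2 x + h1 (g x) * g3 x) S := by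
  refine ⟨fun x hx => ?_, fun x hx => ?_, fun x hx => ?_, fun x hx => ?_, fun x hx => ?_⟩
  · exact (H.1 _ (hm hx)).comp x (G.1 x hx)
  · have := ((H.2 _ (hm hx)).comp x (G.1 x hx)).mul (G.2 x hx)
    refine this.congr_deriv ?_
    simp only [Function.comp]; ring
  · have := (((H.3 _ (hm hx)).comp x (G.1 x hx)).mul ((G.2 x hx).pow 2)).add
      (((H.2 _ (hm hx)).comp x (G.1 x hx)).mul (G.3 x hx))
    refine this.congr_deriv ?_
    simp only [Function.comp, Pi.pow_apply]; norm_num; ring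
  · exact mul_ne_zero (H.4 _ (hm hx)) (G.4 x hx)
  · have a := H.5 _ (hm hx)
    have b := G.5 x hx
    have c : 0 < h1 (g x) ^ 2 := by have := H.4 _ (hm hx); positivity
    have d : 0 < g1 x ^ 4 := by have := G.4 _ hx; positivity
    -- The cocycle rule S(h ∘ g) = (Sh ∘ g) g'² + Sg, multiplied by 2 (h' ∘ g)² g'² to clear
    -- denominators.
    have e1 := mul_lt_mul_of_pos_right a d
    have e2 := mul_lt_mul_of_pos_left b c
    nlinarith

theorem pos_or_neg (H : NegSchwarzianOn h h1 h2 h3 S) (hS : IsPreconnected S) :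
    (∀ x ∈ S, 0 < h1 x) ∨ ∀ x ∈ S, h1 x < 0 := by
  by_contra! hc
  obtain ⟨⟨x, hx, hx0⟩, y, hy, hy0⟩ := hc
  have hcont : ContinuousOn h1 S := fun x hx => (H.2 x hx).continuousAt.continuousWithinAt
  obtain ⟨z, hz, hz0⟩ := hS.intermediate_value hx hy hcont ⟨hx0, hy0⟩
  exact H.4 z hz hz0

/-- For a map with positive derivative `h1` and negative Schwarzian derivative, the second
derivative of `1 / √h1` is positive. -/
theorem exists_inv_sqrt (H : NegSchwarzianOn h h1 h2 h3 S) (hpos : ∀ x ∈ S, 0 < h1 x) :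
    ∃ φ φ1 φ2 : ℝ → ℝ, (∀ x ∈ S, 0 < φ x) ∧ (∀ x ∈ S, h1 x = 1 / φ x ^ 2) ∧
      (∀ x ∈ S, HasDerivAt φ (φ1 x) x) ∧ (∀ x ∈ S, HasDerivAt φ1 (φ2 x) x) ∧
      ∀ x ∈ S, 0 < φ2 x := by
  have hs : ∀ x ∈ S, HasDerivAt (fun y => √(h1 y)) (h2 x / (2 * √(h1 x))) x := fun x hx =>
    (H.2 x hx).sqrt (hpos x hx).ne'
  have hs0 : ∀ x ∈ S, 0 < √(h1 x) := fun x hx => Real.sqrt_pos.2 (hpos x hx)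
  refine ⟨fun x => (√(h1 x))⁻¹, fun x => -h2 x / (2 * √(h1 x) ^ 3),
    fun x => (3 * h2 x ^ 2 - 2 * h3 x * h1 x) / (4 * √(h1 x) ^ 5), fun x hx => ?_,
    fun x hx => ?_, fun x hx => ?_, fun x hx => ?_, fun x hx => ?_⟩
  · exact inv_pos.2 (hs0 x hx)
  · rw [inv_pow, Real.sq_sqrt (hpos x hx).le]; simp
  · have p := hs0 x hx
    refine ((hs x hx).inv p.ne').congr_deriv ?_
    field_simp
  · have p := hs0 x hx
    have := (H.3 x hx).neg.div (((hs x hx).pow 3).const_mul 2) (by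
      simp only [Pi.pow_apply]; positivity)
    refine this.congr_deriv ?_
    have e : h1 x = √(h1 x) ^ 2 := (Real.sq_sqrt (hpos x hx).le).symm
    simp only [Pi.pow_apply, Pi.neg_apply]
    generalize √(h1 x) = s at *
    simp only [e]
    field_simp
    norm_num
    ring
  · have p := hs0 x hx
    have := H.5 x hx
    have : 0 < 3 * h2 x ^ 2 - 2 * h3 x * h1 x := by linarith
    positivity

/-- The one-sided Koebe principle: `(h - h k) / √h1` is strictly increasing. -/
theorem strictMonoOn_sub_mul {φ φ1 φ2 : ℝ → ℝ} (hS : Convex ℝ S)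
    (hh : ∀ x ∈ S, HasDerivAt h (1 / φ x ^ 2) x) (hφ : ∀ x ∈ S, 0 < φ x)
    (hφ1 : ∀ x ∈ S, HasDerivAt φ (φ1 x) x) (hφ2 : ∀ x ∈ S, HasDerivAt φ1 (φ2 x) x)
    (hφ3 : ∀ x ∈ S, 0 < φ2 x) {k : ℝ} (hk : k ∈ S) :
    StrictMonoOn (fun x => (h x - h k) * φ x) S := by
  have hmono : StrictMonoOn h S := by
    refine strictMonoOn_of_deriv_pos hS (fun x hx => (hh x hx).continuousAt.continuousWithinAt) ?_
    intro x hx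
    have hx := interior_subset hx
    rw [(hh x hx).deriv]
    have := hφ x hx
    positivity
  have d1 : ∀ x ∈ S, HasDerivAt (fun x => (h x - h k) * φ x)
      (1 / φ x + (h x - h k) * φ1 x) x := fun x hx => by
    refine (((hh x hx).sub_const (h k)).mul (hφ1 x hx)).congr_deriv ?_
    have := hφ x hx
    field_simp
  have d2 : ∀ x ∈ S, HasDerivAt (fun x => 1 / φ x + (h x - h k) * φ1 x)
      ((h x - h k) * φ2 x) x := fun x hx => by
    have p := hφ x hx
    have := ((hφ1 x hx).inv p.ne').add (((hh x hx).sub_const (h k)).mul (hφ2 x hx))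
    refine (this.congr_deriv ?_).congr_of_eventuallyEq (.of_forall fun y => by simp)
    field_simp
    ring
  -- This first derivative has derivative `(h x - h k) * φ2 x`, of the sign of `x - k`. Its minimum
  -- is thus at `k`, where it equals `1 / φ k > 0`.
  have key : ∀ x ∈ S, 0 < 1 / φ x + (h x - h k) * φ1 x := by
    intro x hx
    have pk : 0 < 1 / φ k + (h k - h k) * φ1 k := by have := hφ k hk; simp [this]
    have hc : ContinuousOn (fun x => 1 / φ x + (h x - h k) * φ1 x) S :=
      fun x hx => (d2 x hx).continuousAt.continuousWithinAt
    rcases le_total k x with hkx | hkx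
    · have hsub : Icc k x ⊆ S := hS.ordConnected.out hk hx
      have : MonotoneOn (fun x => 1 / φ x + (h x - h k) * φ1 x) (Icc k x) := by
        refine monotoneOn_of_deriv_nonneg (convex_Icc _ _) (hc.mono hsub)
          (fun y hy => ((d2 y (hsub (interior_subset hy))).differentiableAt).differentiableWithinAt)
          fun y hy => ?_
        have hy := interior_subset hy
        rw [(d2 y (hsub hy)).deriv]
        exact mul_nonneg (sub_nonneg.2 (hmono.monotoneOn hk (hsub hy) hy.1)) (hφ3 y (hsub hy)).le
      exact pk.trans_le (this (left_mem_Icc.2 hkx) (right_mem_Icc.2 hkx) hkx)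
    · have hsub : Icc x k ⊆ S := hS.ordConnected.out hx hk
      have : AntitoneOn (fun x => 1 / φ x + (h x - h k) * φ1 x) (Icc x k) := by
        refine antitoneOn_of_deriv_nonpos (convex_Icc _ _) (hc.mono hsub)
          (fun y hy => ((d2 y (hsub (interior_subset hy))).differentiableAt).differentiableWithinAt)
          fun y hy => ?_
        have hy := interior_subset hy
        rw [(d2 y (hsub hy)).deriv]
        exact mul_nonpos_of_nonpos_of_nonneg
          (sub_nonpos.2 (hmono.monotoneOn (hsub hy) hk hy.2)) (hφ3 y (hsub hy)).le
      exact pk.trans_le (this (left_mem_Icc.2 hkx) (right_mem_Icc.2 hkx) hkx)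
  refine strictMonoOn_of_deriv_pos hS (fun x hx => (d1 x hx).continuousAt.continuousWithinAt) ?_
  intro x hx
  have hx := interior_subset hx
  rw [(d1 x hx).deriv]
  exact key x hx

theorem strictMonoOn (H : NegSchwarzianOn h h1 h2 h3 S) (hS : Convex ℝ S)
    (hpos : ∀ x ∈ S, 0 < h1 x) : StrictMonoOn h S :=
  strictMonoOn_of_deriv_pos hS H.continuousOn fun x hx => by
    rw [(H.1 x (interior_subset hx)).deriv]
    exact hpos x (interior_subset hx)

theorem strictMonoOn_or_strictAntiOn (H : NegSchwarzianOn h h1 h2 h3 S) (hS : Convex ℝ S) :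
    StrictMonoOn h S ∨ StrictAntiOn h S := by
  rcases H.pos_or_neg hS.isPreconnected with hp | hn
  · exact .inl (H.strictMonoOn hS hp)
  · refine .inr fun x hx y hy hxy => ?_
    have := H.neg_fun.strictMonoOn hS (fun x hx => neg_pos.2 (hn x hx)) hx hy hxy
    simpa using this

/-- `M` measures the room that `[u', v']` leaves around `[u, v]`. Monotonicity of `(h - h k) * φ`,
with `k` over `u'` if `x ≤ y` and over `v'` otherwise, gives `φ x ≤ M * φ y`. -/
theorem koebe_of_pos (H : NegSchwarzianOn h h1 h2 h3 S) (hS : Convex ℝ S)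
    (hpos : ∀ x ∈ S, 0 < h1 x) {u' u v v' M : ℝ} (hu : u' < u) (hv : v < v')
    (hM1 : v - u' ≤ M * (u - u')) (hM2 : v' - u ≤ M * (v' - v))
    (hu' : u' ∈ h '' S) (hv' : v' ∈ h '' S) {x y : ℝ} (hx : x ∈ S) (hy : y ∈ S)
    (hxu : h x ∈ Icc u v) (hyu : h y ∈ Icc u v) : h1 y ≤ M ^ 2 * h1 x := by
  obtain ⟨φ, φ1, φ2, a1, a2, a3, a4, a5⟩ := H.exists_inv_sqrt hpos
  have hh : ∀ x ∈ S, HasDerivAt h (1 / φ x ^ 2) x := fun x hx => a2 x hx ▸ H.1 x hx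
  obtain ⟨k, hk, rfl⟩ := hu'
  obtain ⟨k', hk', rfl⟩ := hv'
  have m1 := strictMonoOn_sub_mul hS hh a1 a3 a4 a5 hk
  have m2 := strictMonoOn_sub_mul hS hh a1 a3 a4 a5 hk'
  have px := a1 x hx
  have py := a1 y hy
  have M0 : 0 < M := by
    by_contra! hc
    have := mul_nonpos_of_nonpos_of_nonneg hc (sub_pos.2 hu).le
    have := hxu.1.trans hxu.2
    linarith
  have key : φ x ≤ M * φ y := by
    rcases le_total x y with hxy | hxy
    · have e : (h x - h k) * φ x ≤ (h y - h k) * φ y := m1.monotoneOn hx hy hxy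
      have e1 : (u - h k) * φ x ≤ (h x - h k) * φ x := by gcongr; exact hxu.1
      have e2 : (h y - h k) * φ y ≤ (v - h k) * φ y := by gcongr; exact hyu.2
      have e3 : (v - h k) * φ y ≤ M * (u - h k) * φ y := by gcongr
      have : (u - h k) * φ x ≤ (u - h k) * (M * φ y) := by linarith
      exact le_of_mul_le_mul_left this (sub_pos.2 hu)
    · have e : (h y - h k') * φ y ≤ (h x - h k') * φ x := m2.monotoneOn hy hx hxy
      have e1 : (h k' - v) * φ x ≤ (h k' - h x) * φ x := by gcongr; exact hxu.2
      have e2 : (h k' - h y) * φ y ≤ (h k' - u) * φ y := by gcongr; exact hyu.1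
      have e3 : (h k' - u) * φ y ≤ M * (h k' - v) * φ y := by gcongr
      have : (h k' - v) * φ x ≤ (h k' - v) * (M * φ y) := by linarith
      exact le_of_mul_le_mul_left this (sub_pos.2 hv)
  rw [a2 x hx, a2 y hy, mul_one_div, div_le_div_iff₀ (by positivity) (by positivity), one_mul,
    ← mul_pow]
  gcongr

/-- By the mean value theorem both difference quotients are values of `h1` over `[u, v]`. The
product form also allows coincident points. -/
theorem distortion_of_pos (H : NegSchwarzianOn h h1 h2 h3 S) (hS : Convex ℝ S)
    (hpos : ∀ x ∈ S, 0 < h1 x) {u' u v v' M : ℝ} (hu : u' < u) (hv : v < v')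
    (hM1 : v - u' ≤ M * (u - u')) (hM2 : v' - u ≤ M * (v' - v))
    (hu' : u' ∈ h '' S) (hv' : v' ∈ h '' S) {a b c d : ℝ}
    (ha : a ∈ S) (hb : b ∈ S) (hc : c ∈ S) (hd : d ∈ S)
    (hau : h a ∈ Icc u v) (hbu : h b ∈ Icc u v) (hcu : h c ∈ Icc u v) (hdu : h d ∈ Icc u v) :
    |h a - h b| * |c - d| ≤ M ^ 2 * (|h c - h d| * |a - b|) := by
  have hm := H.strictMonoOn hS hpos
  have hlip : ∀ p ∈ S, ∀ q ∈ S, h p ∈ Icc u v → h q ∈ Icc u v → p < q →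
      ∃ r ∈ S, h r ∈ Icc u v ∧ h q - h p = h1 r * (q - p) := by
    intro p hp q hq hpu hqu hpq
    have hsub : Icc p q ⊆ S := hS.ordConnected.out hp hq
    obtain ⟨r, hr, e⟩ := exists_hasDerivAt_eq_slope h h1 hpq (H.continuousOn.mono hsub)
      fun x hx => H.1 x (hsub (Ioo_subset_Icc_self hx))
    have hr := Ioo_subset_Icc_self hr
    refine ⟨r, hsub hr, ⟨hpu.1.trans (hm.monotoneOn hp (hsub hr) hr.1),
      (hm.monotoneOn (hsub hr) hq hr.2).trans hqu.2⟩, ?_⟩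
    rw [e, div_mul_cancel₀ _ (sub_pos.2 hpq).ne']
  have main : ∀ a ∈ S, ∀ b ∈ S, ∀ c ∈ S, ∀ d ∈ S, h a ∈ Icc u v → h b ∈ Icc u v →
      h c ∈ Icc u v → h d ∈ Icc u v → a < b → c < d →
      |h a - h b| * |c - d| ≤ M ^ 2 * (|h c - h d| * |a - b|) := by
    intro a ha b hb c hc d hd hau hbu hcu hdu hab hcd
    obtain ⟨r, hr, hru, e⟩ := hlip a ha b hb hau hbu hab
    obtain ⟨s, hs, hsu, e'⟩ := hlip c hc d hd hcu hdu hcd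
    rw [abs_sub_comm (h a), abs_sub_comm (h c), e, e', abs_mul, abs_mul, abs_sub_comm c,
      abs_sub_comm a, abs_of_pos (hpos r hr), abs_of_pos (hpos s hs)]
    have := H.koebe_of_pos hS hpos hu hv hM1 hM2 hu' hv' hs hr hsu hru
    calc h1 r * |b - a| * |d - c| ≤ (M ^ 2 * h1 s) * |b - a| * |d - c| := by gcongr
      _ = _ := by ring
  have main' : ∀ a ∈ S, ∀ b ∈ S, ∀ c ∈ S, ∀ d ∈ S, h a ∈ Icc u v → h b ∈ Icc u v →
      h c ∈ Icc u v → h d ∈ Icc u v → a < b →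
      |h a - h b| * |c - d| ≤ M ^ 2 * (|h c - h d| * |a - b|) := by
    intro a ha b hb c hc d hd hau hbu hcu hdu hab
    rcases lt_trichotomy c d with hcd | rfl | hcd
    · exact main a ha b hb c hc d hd hau hbu hcu hdu hab hcd
    · simp
    · rw [abs_sub_comm c, abs_sub_comm (h c)]
      exact main a ha b hb d hd c hc hau hbu hdu hcu hab hcd
  rcases lt_trichotomy a b with hab | rfl | hab
  · exact main' a ha b hb c hc d hd hau hbu hcu hdu hab
  · simp
  · rw [abs_sub_comm a, abs_sub_comm (h a)]
    exact main' b hb a ha c hc d hd hbu hau hcu hdu hab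

/-- The Koebe principle, in terms of difference quotients. -/
theorem distortion (H : NegSchwarzianOn h h1 h2 h3 S) (hS : Convex ℝ S)
    {u' u v v' M : ℝ} (hu : u' < u) (hv : v < v')
    (hM1 : v - u' ≤ M * (u - u')) (hM2 : v' - u ≤ M * (v' - v))
    (hu' : u' ∈ h '' S) (hv' : v' ∈ h '' S) {a b c d : ℝ}
    (ha : a ∈ S) (hb : b ∈ S) (hc : c ∈ S) (hd : d ∈ S)
    (hau : h a ∈ Icc u v) (hbu : h b ∈ Icc u v) (hcu : h c ∈ Icc u v) (hdu : h d ∈ Icc u v) :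
    |h a - h b| * |c - d| ≤ M ^ 2 * (|h c - h d| * |a - b|) := by
  rcases H.pos_or_neg hS.isPreconnected with hp | hn
  · exact H.distortion_of_pos hS hp hu hv hM1 hM2 hu' hv' ha hb hc hd hau hbu hcu hdu
  · have e : ∀ {x}, h x ∈ Icc u v → -h x ∈ Icc (-v) (-u) := fun hx =>
      ⟨neg_le_neg hx.2, neg_le_neg hx.1⟩
    have e' : ∀ {x}, x ∈ h '' S → -x ∈ (fun x => -h x) '' S := by
      rintro _ ⟨y, hy, rfl⟩
      exact ⟨y, hy, rfl⟩
    have := H.neg_fun.distortion_of_pos hS (fun x hx => neg_pos.2 (hn x hx)) (neg_lt_neg hv)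
      (neg_lt_neg hu) (M := M) (by linarith) (by linarith) (e' hv') (e' hu') ha hb hc hd
      (e hau) (e hbu) (e hcu) (e hdu)
    have t : ∀ x y : ℝ, |-x - -y| = |x - y| := fun x y => by
      rw [← abs_neg]; congr 1; ring
    simpa only [t] using this

/-- An increasing map with negative Schwarzian derivative has at most three fixed points. -/
theorem not_four_fixed (H : NegSchwarzianOn h h1 h2 h3 S) (hS : Convex ℝ S)
    (hpos : ∀ x ∈ S, 0 < h1 x) {t1 t2 t3 t4 : ℝ} (m1 : t1 ∈ S) (m4 : t4 ∈ S)
    (h12 : t1 < t2) (h23 : t2 < t3) (h34 : t3 < t4)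
    (e1 : h t1 = t1) (e2 : h t2 = t2) (e3 : h t3 = t3) (e4 : h t4 = t4) : False := by
  obtain ⟨φ, φ1, φ2, a1, a2, a3, a4, a5⟩ := H.exists_inv_sqrt hpos
  -- The mean value theorem gives `φ = 1` once between consecutive fixed points; Rolle then gives
  -- two zeros of `φ1` and one of `φ2`, which is positive.
  have hsub : Icc t1 t4 ⊆ S := hS.ordConnected.out m1 m4
  have mv : ∀ p q, t1 ≤ p → p < q → q ≤ t4 → h p = p → h q = q →
      ∃ s, p < s ∧ s < q ∧ φ s = 1 := by
    intro p q hp hpq hq ep eq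
    have hs : Icc p q ⊆ S := (Icc_subset_Icc hp hq).trans hsub
    obtain ⟨s, hs', e⟩ := exists_hasDerivAt_eq_slope h h1 hpq (H.continuousOn.mono hs)
      fun x hx => H.1 x (hs (Ioo_subset_Icc_self hx))
    rw [ep, eq, div_self (sub_pos.2 hpq).ne', a2 s (hs (Ioo_subset_Icc_self hs'))] at e
    have p := a1 s (hs (Ioo_subset_Icc_self hs'))
    refine ⟨s, hs'.1, hs'.2, ?_⟩
    field_simp at e
    nlinarith
  obtain ⟨s1, b1, c1, f1⟩ := mv t1 t2 le_rfl h12 (by linarith) e1 e2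
  obtain ⟨s2, b2, c2, f2⟩ := mv t2 t3 (by linarith) h23 (by linarith) e2 e3
  obtain ⟨s3, b3, c3, f3⟩ := mv t3 t4 (by linarith) h34 le_rfl e3 e4
  have hφc : ContinuousOn φ S := fun x hx => (a3 x hx).continuousAt.continuousWithinAt
  have hφc1 : ContinuousOn φ1 S := fun x hx => (a4 x hx).continuousAt.continuousWithinAt
  have sub : ∀ p q, t1 ≤ p → q ≤ t4 → Icc p q ⊆ S := fun p q hp hq =>
    (Icc_subset_Icc hp hq).trans hsub
  obtain ⟨r1, hr1, g1⟩ := exists_hasDerivAt_eq_zero (c1.trans b2)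
    (hφc.mono (sub _ _ (by linarith) (by linarith))) (f1.trans f2.symm)
    fun x hx => a3 x (sub s1 s2 (by linarith) (by linarith) (Ioo_subset_Icc_self hx))
  obtain ⟨r2, hr2, g2⟩ := exists_hasDerivAt_eq_zero (c2.trans b3)
    (hφc.mono (sub _ _ (by linarith) (by linarith))) (f2.trans f3.symm)
    fun x hx => a3 x (sub s2 s3 (by linarith) (by linarith) (Ioo_subset_Icc_self hx))
  have q1 := hr1.1; have q2 := hr1.2; have q3 := hr2.1; have q4 := hr2.2
  obtain ⟨r, hr, g⟩ := exists_hasDerivAt_eq_zero (q2.trans q3)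
    (hφc1.mono (sub _ _ (by linarith) (by linarith))) (g1.trans g2.symm)
    fun x hx => a4 x (sub r1 r2 (by linarith) (by linarith) (Ioo_subset_Icc_self hx))
  exact (a5 r (sub r1 r2 (by linarith) (by linarith) (Ioo_subset_Icc_self hr))).ne' g

end NegSchwarzianOn

/-! ### Domains of the iterates -/

/-- The points of `(0,1)` outside the exceptional set. -/
def regularSet (C : Set ℝ) : Set ℝ := Ioo 0 1 \ C

/-- The points at which `f^[n]` is a local diffeomorphism of `(0,1)`. -/
def iterDomain (f : ℝ → ℝ) (C : Set ℝ) (n : ℕ) : Set ℝ := {x | ∀ i < n, f^[i] x ∈ regularSet C}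

/-- The points of `(0,1)` whose whole orbit avoids the exceptional set. -/
def survivorSet (f : ℝ → ℝ) (C : Set ℝ) : Set ℝ := {x | ∀ i, f^[i] x ∈ regularSet C}

theorem iterDomain_zero (f : ℝ → ℝ) (C : Set ℝ) : iterDomain f C 0 = univ := by
  ext x; simp [iterDomain]

theorem iterDomain_one (f : ℝ → ℝ) (C : Set ℝ) : iterDomain f C 1 = regularSet C := by
  ext x; simp [iterDomain]

theorem mem_iterDomain_add {f : ℝ → ℝ} {C : Set ℝ} {m n : ℕ} {x : ℝ} :
    x ∈ iterDomain f C (m + n) ↔ x ∈ iterDomain f C m ∧ f^[m] x ∈ iterDomain f C n := by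
  simp only [iterDomain, mem_ofPred_eq]
  refine ⟨fun h => ⟨fun i hi => h i (by omega), fun i hi => ?_⟩, fun h i hi => ?_⟩
  · rw [← Function.iterate_add_apply]
    exact h _ (by omega)
  · rcases lt_or_ge i m with him | him
    · exact h.1 i him
    · obtain ⟨j, rfl⟩ := Nat.exists_eq_add_of_le him
      have := h.2 j (by omega)
      rwa [← Function.iterate_add_apply, add_comm j] at this

theorem iterDomain_anti {f : ℝ → ℝ} {C : Set ℝ} {m n : ℕ} (h : m ≤ n) :
    iterDomain f C n ⊆ iterDomain f C m := fun _ hx i hi => hx i (hi.trans_le h)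

theorem survivorSet_subset {f : ℝ → ℝ} {C : Set ℝ} {n : ℕ} :
    survivorSet f C ⊆ iterDomain f C n := fun _ hx i _ => hx i

theorem mem_survivorSet_of_forall {f : ℝ → ℝ} {C : Set ℝ} {x : ℝ}
    (h : ∀ n, x ∈ iterDomain f C n) : x ∈ survivorSet f C := fun i => h (i + 1) i i.lt_succ_self

theorem iterate_mem_survivorSet {f : ℝ → ℝ} {C : Set ℝ} {x : ℝ} (hx : x ∈ survivorSet f C)
    (n : ℕ) : f^[n] x ∈ survivorSet f C := fun i => by
  rw [← Function.iterate_add_apply]; exact hx _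

namespace IsPiecewiseNegSchwarzian

variable {f : ℝ → ℝ} {C : Set ℝ}

theorem isOpen_regularSet (hf : IsPiecewiseNegSchwarzian f C) : IsOpen (regularSet C) :=
  isOpen_Ioo.sdiff hf.finite.isClosed

theorem negSchwarzianOn (hf : IsPiecewiseNegSchwarzian f C) :
    NegSchwarzianOn f (deriv f) (deriv^[2] f) (deriv^[3] f) (regularSet C) := by
  have hO := hf.isOpen_regularSet
  have hsub : regularSet C ⊆ Icc 0 1 \ C := sdiff_subset_sdiff_left Ioo_subset_Icc_self
  have h0 : ContDiffOn ℝ 3 f (regularSet C) := hf.contDiffOn.mono hsub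
  have h1 : ContDiffOn ℝ 2 (deriv f) (regularSet C) := h0.deriv_of_isOpen hO (by norm_num)
  have h2 : ContDiffOn ℝ 1 (deriv^[2] f) (regularSet C) := h1.deriv_of_isOpen hO (by norm_num)
  have hd : ∀ {g : ℝ → ℝ} {n : ℕ}, n ≠ 0 → ContDiffOn ℝ n g (regularSet C) →
      ∀ x ∈ regularSet C, HasDerivAt g (deriv g x) x := fun hn hg x hx =>
    ((hg.differentiableOn (by exact_mod_cast hn)).differentiableAt
      (hO.mem_nhds hx)).hasDerivAt
  have heq : ∀ x ∈ regularSet C, ∀ n,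
      iteratedDerivWithin n f (Icc 0 1 \ C) x = deriv^[n] f x := by
    intro x hx n
    have e : (Icc 0 1 \ C : Set ℝ) =ᶠ[𝓝 x] regularSet C := by
      filter_upwards [hO.mem_nhds hx] with y hy
      exact propext ⟨fun _ => hy, fun _ => hsub hy⟩
    rw [iteratedDerivWithin, iteratedFDerivWithin_congr_set e, ← iteratedDerivWithin]
    exact iteratedDerivWithin_of_isOpen_eq_iterate hO hx
  have heq1 : ∀ x ∈ regularSet C, derivWithin f (Icc 0 1 \ C) x = deriv f x := fun x hx =>
    derivWithin_of_mem_nhds (mem_of_superset (hO.mem_nhds hx) hsub)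
  have hne : ∀ x ∈ regularSet C, deriv f x ≠ 0 := fun x hx =>
    heq1 x hx ▸ hf.deriv_ne_zero x (hsub hx)
  refine ⟨hd (n := 3) (by norm_num) h0, fun x hx => ?_, fun x hx => ?_, hne, fun x hx => ?_⟩
  · exact hd (n := 2) (by norm_num) h1 x hx
  · rw [Function.iterate_succ_apply' deriv 2]
    exact hd (n := 1) (by norm_num) (by exact_mod_cast h2) x hx
  · have := hf.schwarzian_neg x (hsub hx)
    have h0 := hne x hx
    rw [schwarzianWithin, heq x hx, heq x hx, heq1 x hx] at this
    have p : 0 < deriv f x ^ 2 := by positivity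
    have := mul_neg_of_neg_of_pos this p
    have e : (deriv^[3] f x / deriv f x - 3 / 2 * (deriv^[2] f x / deriv f x) ^ 2) * deriv f x ^ 2
      = deriv^[3] f x * deriv f x - 3 / 2 * deriv^[2] f x ^ 2 := by field_simp
    rw [e] at this
    linarith

/-- An interior point sent to 0 or 1 would be a local extremum, where the derivative vanishes. -/
theorem mapsTo_Ioo (hf : IsPiecewiseNegSchwarzian f C) :
    MapsTo f (regularSet C) (Ioo 0 1) := by
  intro x hx
  have hm : ∀ᶠ y in 𝓝 x, f y ∈ Icc (0 : ℝ) 1 := by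
    filter_upwards [hf.isOpen_regularSet.mem_nhds hx] with y hy
    exact hf.mapsTo ⟨Ioo_subset_Icc_self hy.1, hy.2⟩
  have h := hm.self_of_nhds
  have hne := hf.negSchwarzianOn.ne_zero x hx
  refine ⟨h.1.lt_of_ne fun e => hne ?_, h.2.lt_of_ne fun e => hne ?_⟩
  · exact IsLocalMin.deriv_eq_zero (hm.mono fun y hy => e ▸ hy.1)
  · exact IsLocalMax.deriv_eq_zero (hm.mono fun y hy => e ▸ hy.2)

theorem iterDomain_succ (n : ℕ) :
    iterDomain f C (n + 1) = regularSet C ∩ f ⁻¹' iterDomain f C n := by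
  ext x
  rw [add_comm, mem_iterDomain_add, iterDomain_one]; rfl

theorem isOpen_iterDomain (hf : IsPiecewiseNegSchwarzian f C) (n : ℕ) :
    IsOpen (iterDomain f C n) := by
  induction n with
  | zero => rw [iterDomain_zero]; exact isOpen_univ
  | succ n ih =>
    rw [iterDomain_succ]
    exact hf.negSchwarzianOn.continuousOn.isOpen_inter_preimage hf.isOpen_regularSet ih

theorem exists_negSchwarzianOn_iterate (hf : IsPiecewiseNegSchwarzian f C) {n : ℕ} (hn : 1 ≤ n) :
    ∃ h1 h2 h3, NegSchwarzianOn f^[n] h1 h2 h3 (iterDomain f C n) := by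
  induction n, hn using Nat.le_induction with
  | base => exact ⟨_, _, _, by rw [iterDomain_one]; exact hf.negSchwarzianOn⟩
  | succ n hn ih =>
    obtain ⟨h1, h2, h3, H⟩ := ih
    rw [iterDomain_succ]
    exact ⟨_, _, _, H.comp (hf.negSchwarzianOn.mono inter_subset_left) fun x hx => hx.2⟩

theorem continuousOn_iterate (hf : IsPiecewiseNegSchwarzian f C) (n : ℕ) :
    ContinuousOn f^[n] (iterDomain f C n) := by
  rcases Nat.eq_zero_or_pos n with rfl | hn
  · exact continuousOn_id
  · obtain ⟨_, _, _, H⟩ := hf.exists_negSchwarzianOn_iterate hn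
    exact H.continuousOn

theorem iterate_mem_Ioo (hf : IsPiecewiseNegSchwarzian f C) {n : ℕ} {x : ℝ}
    (hx0 : x ∈ Ioo (0 : ℝ) 1) (hx : x ∈ iterDomain f C n) : f^[n] x ∈ Ioo (0 : ℝ) 1 := by
  cases n with
  | zero => exact hx0
  | succ n =>
    rw [Function.iterate_succ_apply']
    exact hf.mapsTo_Ioo (hx n n.lt_succ_self)

theorem mem_survivorSet_of_notMem_preorbit (hf : IsPiecewiseNegSchwarzian f C) {x : ℝ}
    (hx : x ∈ Ioo (0 : ℝ) 1) (h : x ∉ preorbit f C) : x ∈ survivorSet f C := by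
  refine mem_survivorSet_of_forall fun n => ?_
  induction n with
  | zero => simp [iterDomain_zero]
  | succ n ih =>
    rw [mem_iterDomain_add, iterDomain_one]
    exact ⟨ih, hf.iterate_mem_Ioo hx ih, fun hc => h ⟨n, hc⟩⟩

theorem notMem_preorbit {x : ℝ} (hx : x ∈ survivorSet f C) : x ∉ preorbit f C :=
  fun ⟨j, hj⟩ => (hx j).2 hj

end IsPiecewiseNegSchwarzian

/-! ### One-sided limits and the dynamics of lateral points -/

/-- Strict monotonicity keeps the infimum from being attained, so the limit is approached from one
side only. That side is what a lateral point records. The three companions follow by reflection. -/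
theorem StrictMonoOn.exists_tendsto_nhdsGT {f : ℝ → ℝ} {p q A B : ℝ} (hpq : p < q)
    (hf : StrictMonoOn f (Ioo p q)) (hm : MapsTo f (Ioo p q) (Icc A B)) :
    ∃ L ∈ Ico A B, Tendsto f (𝓝[>] p) (𝓝[>] L) := by
  have hb : BddBelow (f '' Ioo p q) := ⟨A, by rintro _ ⟨y, hy, rfl⟩; exact (hm hy).1⟩
  have hne := nonempty_Ioo.2 hpq
  have hlt : ∀ y ∈ Ioo p q, sInf (f '' Ioo p q) < f y := fun y hy => by
    obtain ⟨z, hz⟩ := exists_between hy.1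
    have hz' : z ∈ Ioo p q := ⟨hz.1, hz.2.trans hy.2⟩
    exact (csInf_le hb (mem_image_of_mem f hz')).trans_lt (hf hz' hy hz.2)
  refine ⟨sInf (f '' Ioo p q), ⟨le_csInf (hne.image f) ?_, ?_⟩, ?_⟩
  · rintro _ ⟨y, hy, rfl⟩; exact (hm hy).1
  · obtain ⟨y, hy⟩ := hne
    exact (hlt y hy).trans_le (hm hy).2
  · refine tendsto_nhdsWithin_iff.2 ⟨hf.monotoneOn.tendsto_nhdsWithin_Ioo_right hne hb, ?_⟩
    filter_upwards [Ioo_mem_nhdsGT hpq] with y hy using hlt y hy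

theorem StrictAntiOn.exists_tendsto_nhdsGT {f : ℝ → ℝ} {p q A B : ℝ} (hpq : p < q)
    (hf : StrictAntiOn f (Ioo p q)) (hm : MapsTo f (Ioo p q) (Icc A B)) :
    ∃ L ∈ Ioc A B, Tendsto f (𝓝[>] p) (𝓝[<] L) := by
  obtain ⟨L, hL, h⟩ := StrictMonoOn.exists_tendsto_nhdsGT (f := fun x => -f x) (A := -B) (B := -A)
    hpq hf.neg fun x hx => ⟨neg_le_neg (hm hx).2, neg_le_neg (hm hx).1⟩
  refine ⟨-L, ⟨by linarith [hL.2], by linarith [hL.1]⟩, ?_⟩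
  have := tendsto_neg_nhdsGT.comp h
  simpa [Function.comp_def] using this

theorem StrictMonoOn.exists_tendsto_nhdsLT {f : ℝ → ℝ} {p q A B : ℝ} (hpq : q < p)
    (hf : StrictMonoOn f (Ioo q p)) (hm : MapsTo f (Ioo q p) (Icc A B)) :
    ∃ L ∈ Ioc A B, Tendsto f (𝓝[<] p) (𝓝[<] L) := by
  have hmap : MapsTo (fun x : ℝ => -x) (Ioo (-p) (-q)) (Ioo q p) :=
    fun x hx => ⟨by linarith [hx.2], by linarith [hx.1]⟩
  obtain ⟨L, hL, h⟩ := StrictAntiOn.exists_tendsto_nhdsGT (f := fun x => f (-x)) (A := A) (B := B)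
    (neg_lt_neg hpq) (fun x hx y hy hxy => hf (hmap hy) (hmap hx) (neg_lt_neg hxy))
    fun x hx => hm (hmap hx)
  refine ⟨L, hL, ?_⟩
  have := h.comp tendsto_neg_nhdsLT
  simpa [Function.comp_def] using this

theorem StrictAntiOn.exists_tendsto_nhdsLT {f : ℝ → ℝ} {p q A B : ℝ} (hpq : q < p)
    (hf : StrictAntiOn f (Ioo q p)) (hm : MapsTo f (Ioo q p) (Icc A B)) :
    ∃ L ∈ Ico A B, Tendsto f (𝓝[<] p) (𝓝[>] L) := by
  have hmap : MapsTo (fun x : ℝ => -x) (Ioo (-p) (-q)) (Ioo q p) :=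
    fun x hx => ⟨by linarith [hx.2], by linarith [hx.1]⟩
  obtain ⟨L, hL, h⟩ := StrictMonoOn.exists_tendsto_nhdsGT (f := fun x => f (-x)) (A := A) (B := B)
    (neg_lt_neg hpq) (fun x hx y hy hxy => hf (hmap hy) (hmap hx) (neg_lt_neg hxy))
    fun x hx => hm (hmap hx)
  refine ⟨L, hL, ?_⟩
  have := h.comp tendsto_neg_nhdsLT
  simpa [Function.comp_def] using this

/-- The one-sided neighbourhoods of a lateral point. -/
noncomputable def lateralNhds (α : ℂ) : Filter ℝ := if α.im < 0 then 𝓝[<] α.re else 𝓝[>] α.re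

theorem lateralNhds_sub_I (p : ℝ) : lateralNhds ((p : ℂ) - Complex.I) = 𝓝[<] p := by
  simp [lateralNhds]

theorem lateralNhds_add_I (p : ℝ) : lateralNhds ((p : ℂ) + Complex.I) = 𝓝[>] p := by
  simp [lateralNhds]

instance lateralNhds_neBot (α : ℂ) : (lateralNhds α).NeBot := by
  unfold lateralNhds; split_ifs <;> infer_instance

theorem lateralNhds_le_nhds (α : ℂ) : lateralNhds α ≤ 𝓝 α.re := by
  unfold lateralNhds; split_ifs <;> exact nhdsWithin_le_nhds

theorem sub_I_mem_lateralPoints {p : ℝ} (hp : p ∈ Ioc (0 : ℝ) 1) :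
    (p : ℂ) - Complex.I ∈ lateralPoints := .inl ⟨p, hp, rfl⟩

theorem add_I_mem_lateralPoints {p : ℝ} (hp : p ∈ Ico (0 : ℝ) 1) :
    (p : ℂ) + Complex.I ∈ lateralPoints := .inr ⟨p, hp, rfl⟩

theorem re_mem_of_mem_lateralPoints {α : ℂ} (hα : α ∈ lateralPoints) : α.re ∈ Icc (0 : ℝ) 1 := by
  rcases hα with ⟨p, hp, rfl⟩ | ⟨p, hp, rfl⟩
  · simpa using Ioc_subset_Icc_self hp
  · simpa using Ico_subset_Icc_self hp

theorem mem_lateralExceptionalSet_of_re_mem {C : Set ℝ} {α : ℂ} (hα : α ∈ lateralPoints)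
    (hC : α.re ∈ C) : α ∈ lateralExceptionalSet C := by
  rcases hα with ⟨p, hp, rfl⟩ | ⟨p, hp, rfl⟩
  · exact .inl ⟨p, by simpa using hC, rfl⟩
  · exact .inr ⟨p, by simpa using hC, rfl⟩

/-- Identifies the limit of a monotone orbit as a lateral point, side included; this is how
periodicity of the limit is obtained. -/
theorem eq_of_tendsto_lateralNhds {ι : Type*} {l : Filter ι} [l.NeBot] {u : ι → ℝ} {α β : ℂ}
    (hα : α ∈ lateralPoints) (hβ : β ∈ lateralPoints) (h : Tendsto u l (lateralNhds α))
    (h' : Tendsto u l (lateralNhds β)) : α = β := by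
  have hre : α.re = β.re := tendsto_nhds_unique (h.mono_right (lateralNhds_le_nhds α))
    (h'.mono_right (lateralNhds_le_nhds β))
  have contra : ∀ p : ℝ, Tendsto u l (𝓝[<] p) → Tendsto u l (𝓝[>] p) → False := fun p h1 h2 => by
    obtain ⟨i, hi1, hi2⟩ := ((tendsto_nhdsWithin_iff.1 h1).2.and
      (tendsto_nhdsWithin_iff.1 h2).2).exists
    exact lt_asymm (mem_Iio.1 hi1) (mem_Ioi.1 hi2)
  rcases hα with ⟨p, hp, rfl⟩ | ⟨p, hp, rfl⟩ <;> rcases hβ with ⟨q, hq, rfl⟩ | ⟨q, hq, rfl⟩ <;>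
    obtain rfl : p = q := (by simpa using hre)
  · rfl
  · rw [lateralNhds_sub_I] at h
    rw [lateralNhds_add_I] at h'
    exact (contra p h h').elim
  · rw [lateralNhds_add_I] at h
    rw [lateralNhds_sub_I] at h'
    exact (contra p h' h).elim
  · rfl

/-- The closure of the orbits of the lateral exceptional points. -/
def postcriticalClosure (f : ℝ → ℝ) (C : Set ℝ) : Set ℝ :=
  ⋃ α ∈ lateralExceptionalSet C, closure (Complex.re '' lateralOrbit f α)

namespace IsPiecewiseNegSchwarzian

variable {f : ℝ → ℝ} {C : Set ℝ}

theorem exists_Ioo_subset_right (hf : IsPiecewiseNegSchwarzian f C) {p : ℝ}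
    (hp : p ∈ Ico (0 : ℝ) 1) : ∃ q, p < q ∧ Ioo p q ⊆ regularSet C := by
  have h1 : ∀ᶠ x in 𝓝[>] p, x ∈ (C \ {p})ᶜ := nhdsWithin_le_nhds
    ((hf.finite.subset sdiff_subset).isClosed.isOpen_compl.mem_nhds (by simp))
  obtain ⟨q, hq, h⟩ := mem_nhdsGT_iff_exists_Ioo_subset.1 (h1.and (Ioo_mem_nhdsGT hp.2))
  refine ⟨q, hq, fun x hx => ?_⟩
  have := h hx
  exact ⟨⟨hp.1.trans_lt this.2.1, this.2.2⟩, fun hC => this.1 ⟨hC, hx.1.ne'⟩⟩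

theorem exists_Ioo_subset_left (hf : IsPiecewiseNegSchwarzian f C) {p : ℝ}
    (hp : p ∈ Ioc (0 : ℝ) 1) : ∃ q, q < p ∧ Ioo q p ⊆ regularSet C := by
  have h1 : ∀ᶠ x in 𝓝[<] p, x ∈ (C \ {p})ᶜ := nhdsWithin_le_nhds
    ((hf.finite.subset sdiff_subset).isClosed.isOpen_compl.mem_nhds (by simp))
  obtain ⟨q, hq, h⟩ := mem_nhdsLT_iff_exists_Ioo_subset.1 (h1.and (Ioo_mem_nhdsLT hp.1))
  refine ⟨q, hq, fun x hx => ?_⟩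
  have := h hx
  exact ⟨⟨this.2.1, this.2.2.trans_le hp.2⟩, fun hC => this.1 ⟨hC, hx.2.ne⟩⟩

/-- Close to a point, on one side of it, the derivative has constant sign, and this sign decides
from which side `f` approaches its limit. The formal action on ℂ thus becomes a statement about
one-sided filters, which can be iterated. -/
theorem tendsto_lateralStep (hf : IsPiecewiseNegSchwarzian f C) {α : ℂ}
    (hα : α ∈ lateralPoints) :
    lateralStep f α ∈ lateralPoints ∧
      Tendsto f (lateralNhds α) (lateralNhds (lateralStep f α)) := by
  have hmaps : MapsTo f (regularSet C) (Icc 0 1) := hf.mapsTo_Ioo.mono_right Ioo_subset_Icc_self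
  have hlim : ∀ {l : Filter ℝ} {s : ℝ}, (∀ᶠ x in l, deriv f x / |deriv f x| = s) →
      Tendsto (fun x => deriv f x / |deriv f x|) l (𝓝 s) := fun h =>
    tendsto_const_nhds.congr' (h.mono fun x hx => hx.symm)
  rcases hα with ⟨p, hp, rfl⟩ | ⟨p, hp, rfl⟩
  · obtain ⟨q, hq, hsub⟩ := hf.exists_Ioo_subset_left hp
    have H := hf.negSchwarzianOn.mono hsub
    have hmem := Ioo_mem_nhdsLT hq
    rw [lateralNhds_sub_I]
    rcases H.pos_or_neg isPreconnected_Ioo with hs | hs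
    · obtain ⟨L, hL, h⟩ := StrictMonoOn.exists_tendsto_nhdsLT hq
        (H.strictMonoOn (convex_Ioo _ _) hs) (hmaps.mono_left hsub)
      have hd : Tendsto (fun x => deriv f x / |deriv f x|) (𝓝[<] p) (𝓝 1) := hlim <| by
        filter_upwards [hmem] with x hx
        rw [abs_of_pos (hs x hx), div_self (hs x hx).ne']
      have e : lateralStep f (p - Complex.I) = L - Complex.I := by
        simp [lateralStep, leftLim_eq_of_tendsto hd,
          leftLim_eq_of_tendsto (tendsto_nhdsWithin_iff.1 h).1]
      rw [e, lateralNhds_sub_I]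
      exact ⟨sub_I_mem_lateralPoints hL, h⟩
    · have hs' : StrictAntiOn f (Ioo q p) := strictAntiOn_of_deriv_neg (convex_Ioo _ _)
        H.continuousOn fun x hx => hs x (interior_subset hx)
      obtain ⟨L, hL, h⟩ := StrictAntiOn.exists_tendsto_nhdsLT hq hs' (hmaps.mono_left hsub)
      have hd : Tendsto (fun x => deriv f x / |deriv f x|) (𝓝[<] p) (𝓝 (-1)) := hlim <| by
        filter_upwards [hmem] with x hx
        rw [abs_of_neg (hs x hx), div_neg, div_self (hs x hx).ne]
      have e : lateralStep f (p - Complex.I) = L + Complex.I := by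
        simp [lateralStep, leftLim_eq_of_tendsto hd,
          leftLim_eq_of_tendsto (tendsto_nhdsWithin_iff.1 h).1]
      rw [e, lateralNhds_add_I]
      exact ⟨add_I_mem_lateralPoints hL, h⟩
  · obtain ⟨q, hq, hsub⟩ := hf.exists_Ioo_subset_right hp
    have H := hf.negSchwarzianOn.mono hsub
    have hmem := Ioo_mem_nhdsGT hq
    rw [lateralNhds_add_I]
    rcases H.pos_or_neg isPreconnected_Ioo with hs | hs
    · obtain ⟨L, hL, h⟩ := StrictMonoOn.exists_tendsto_nhdsGT hq
        (H.strictMonoOn (convex_Ioo _ _) hs) (hmaps.mono_left hsub)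
      have hd : Tendsto (fun x => deriv f x / |deriv f x|) (𝓝[>] p) (𝓝 1) := hlim <| by
        filter_upwards [hmem] with x hx
        rw [abs_of_pos (hs x hx), div_self (hs x hx).ne']
      have e : lateralStep f (p + Complex.I) = L + Complex.I := by
        simp [lateralStep, rightLim_eq_of_tendsto hd,
          rightLim_eq_of_tendsto (tendsto_nhdsWithin_iff.1 h).1]
      rw [e, lateralNhds_add_I]
      exact ⟨add_I_mem_lateralPoints hL, h⟩
    · have hs' : StrictAntiOn f (Ioo p q) := strictAntiOn_of_deriv_neg (convex_Ioo _ _)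
        H.continuousOn fun x hx => hs x (interior_subset hx)
      obtain ⟨L, hL, h⟩ := StrictAntiOn.exists_tendsto_nhdsGT hq hs' (hmaps.mono_left hsub)
      have hd : Tendsto (fun x => deriv f x / |deriv f x|) (𝓝[>] p) (𝓝 (-1)) := hlim <| by
        filter_upwards [hmem] with x hx
        rw [abs_of_neg (hs x hx), div_neg, div_self (hs x hx).ne]
      have e : lateralStep f (p + Complex.I) = L - Complex.I := by
        simp [lateralStep, rightLim_eq_of_tendsto hd,
          rightLim_eq_of_tendsto (tendsto_nhdsWithin_iff.1 h).1, sub_eq_add_neg]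
      rw [e, lateralNhds_sub_I]
      exact ⟨sub_I_mem_lateralPoints hL, h⟩

theorem tendsto_iterate_lateralStep (hf : IsPiecewiseNegSchwarzian f C) {α : ℂ}
    (hα : α ∈ lateralPoints) (n : ℕ) :
    (lateralStep f)^[n] α ∈ lateralPoints ∧
      Tendsto f^[n] (lateralNhds α) (lateralNhds ((lateralStep f)^[n] α)) := by
  induction n with
  | zero => exact ⟨hα, tendsto_id⟩
  | succ n ih =>
    rw [Function.iterate_succ_apply', Function.iterate_succ' f]
    have := hf.tendsto_lateralStep ih.1
    exact ⟨this.1, this.2.comp ih.2⟩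

theorem isClosed_postcriticalClosure (hf : IsPiecewiseNegSchwarzian f C) :
    IsClosed (postcriticalClosure f C) := by
  have hfin : (lateralExceptionalSet C).Finite := by
    refine ((hf.finite.image fun c : ℝ => (c : ℂ) - Complex.I).union
      (hf.finite.image fun c : ℝ => (c : ℂ) + Complex.I)).subset ?_
    rintro α (⟨c, hc, rfl⟩ | ⟨c, hc, rfl⟩)
    · exact .inl ⟨c, hc, rfl⟩
    · exact .inr ⟨c, hc, rfl⟩
  exact hfin.isClosed_biUnion fun _ _ => isClosed_closure

/-- The one-sided limits of `f^[n]` at an end point of a component of its domain belong to the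
closure of the orbits of the lateral exceptional points. -/
theorem exists_tendsto_of_notMem_iterDomain (hf : IsPiecewiseNegSchwarzian f C) {α : ℂ} {n : ℕ}
    (hα : α ∈ lateralPoints) (h0 : α.re ∈ Ioo (0 : ℝ) 1) (hn : α.re ∉ iterDomain f C n) :
    ∃ A ∈ postcriticalClosure f C, Tendsto f^[n] (lateralNhds α) (𝓝 A) := by
  classical
  have hex : ∃ i, i < n ∧ f^[i] α.re ∉ regularSet C := by
    by_contra! hc
    exact hn hc
  -- At the first exit time `i` the orbit is still in (0,1), so it exits through `C`. Since `f^[i]`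
  -- is continuous at `α.re`, the lateral orbit has become that of a lateral exceptional point.
  obtain ⟨hin, hi⟩ := Nat.find_spec hex
  set i := Nat.find hex
  have hdom : α.re ∈ iterDomain f C i := fun j hj => by
    by_contra hc
    exact Nat.find_min hex hj ⟨hj.trans hin, hc⟩
  have hC : f^[i] α.re ∈ C := by
    by_contra hc
    exact hi ⟨hf.iterate_mem_Ioo h0 hdom, hc⟩
  obtain ⟨hmem, ht⟩ := hf.tendsto_iterate_lateralStep hα i
  have hcont : Tendsto f^[i] (lateralNhds α) (𝓝 (f^[i] α.re)) :=
    ((hf.continuousOn_iterate i).continuousAt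
      ((hf.isOpen_iterDomain i).mem_nhds hdom)).tendsto.mono_left (lateralNhds_le_nhds α)
  have hre : ((lateralStep f)^[i] α).re = f^[i] α.re :=
    tendsto_nhds_unique (ht.mono_right (lateralNhds_le_nhds _)) hcont
  refine ⟨((lateralStep f)^[n] α).re, mem_biUnion
    (mem_lateralExceptionalSet_of_re_mem hmem (hre ▸ hC)) (subset_closure ?_),
    (hf.tendsto_iterate_lateralStep hα n).2.mono_right (lateralNhds_le_nhds _)⟩
  refine mem_image_of_mem _ ⟨n - i, ?_⟩
  rw [← Function.iterate_add_apply, Nat.sub_add_cancel hin.le]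

end IsPiecewiseNegSchwarzian

/-! ### Branches of the iterates away from the postcritical closure -/

theorem IsOpen.exists_left_endpoint {U : Set ℝ} (hU : IsOpen U) {x p : ℝ} (hx : x ∈ U)
    (hp : p ∉ U) (hpx : p ≤ x) : ∃ a, p ≤ a ∧ a < x ∧ a ∉ U ∧ Ioc a x ⊆ U := by
  have hc : IsCompact (Icc p x ∩ Uᶜ) := isCompact_Icc.inter_right hU.isClosed_compl
  have hmem := hc.sSup_mem ⟨p, left_mem_Icc.2 hpx, hp⟩
  refine ⟨sSup (Icc p x ∩ Uᶜ), hmem.1.1, hmem.1.2.lt_of_ne ?_, hmem.2, fun y hy => ?_⟩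
  · intro e
    exact hmem.2 (e.symm ▸ hx)
  · by_contra hyU
    exact hy.1.not_ge (le_csSup hc.bddAbove ⟨⟨hmem.1.1.trans hy.1.le, hy.2⟩, hyU⟩)

theorem IsOpen.exists_right_endpoint {U : Set ℝ} (hU : IsOpen U) {x p : ℝ} (hx : x ∈ U)
    (hp : p ∉ U) (hpx : x ≤ p) : ∃ b, b ≤ p ∧ x < b ∧ b ∉ U ∧ Ico x b ⊆ U := by
  have hc : IsCompact (Icc x p ∩ Uᶜ) := isCompact_Icc.inter_right hU.isClosed_compl
  have hmem := hc.sInf_mem ⟨p, right_mem_Icc.2 hpx, hp⟩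
  refine ⟨sInf (Icc x p ∩ Uᶜ), hmem.1.2, hmem.1.1.lt_of_ne ?_, hmem.2, fun y hy => ?_⟩
  · intro e
    exact hmem.2 (e ▸ hx)
  · by_contra hyU
    exact hy.2.not_ge (csInf_le hc.bddBelow ⟨⟨hy.1, hy.2.le.trans hmem.1.2⟩, hyU⟩)

namespace IsPiecewiseNegSchwarzian

variable {f : ℝ → ℝ} {C : Set ℝ}

theorem iterDomain_subset_Ioo {n : ℕ} (hn : 1 ≤ n) : iterDomain f C n ⊆ Ioo 0 1 :=
  fun _ hx => (hx 0 hn).1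

/-- The restriction of `f^[n]` to a component of its domain covers each interval that meets its
image and avoids the closure of the orbits of the lateral exceptional points. -/
theorem exists_Icc_subset_image (hf : IsPiecewiseNegSchwarzian f C) {n : ℕ} (hn : 1 ≤ n) {x : ℝ}
    (hx : x ∈ iterDomain f C n) (hl : ¬ Ioc 0 x ⊆ iterDomain f C n)
    (hr : ¬ Ico x 1 ⊆ iterDomain f C n) {u v : ℝ}
    (hV : ∀ y ∈ Icc u v, y ∉ postcriticalClosure f C) (hxu : f^[n] x ∈ Icc u v) :
    ∃ a b, a < x ∧ x < b ∧ a ∉ iterDomain f C n ∧ b ∉ iterDomain f C n ∧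
      Ioo a b ⊆ iterDomain f C n ∧ Icc u v ⊆ f^[n] '' Ioo a b := by
  have hO := hf.isOpen_iterDomain n
  have hx01 := iterDomain_subset_Ioo hn hx
  obtain ⟨p, hp, hpU⟩ := not_subset.1 hl
  obtain ⟨q, hq, hqU⟩ := not_subset.1 hr
  obtain ⟨a, hpa, hax, haU, ha⟩ := hO.exists_left_endpoint hx hpU hp.2
  obtain ⟨b, hbq, hxb, hbU, hb⟩ := hO.exists_right_endpoint hx hqU hq.1
  have hsub : Ioo a b ⊆ iterDomain f C n := fun y hy => by
    rcases le_total y x with h | h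
    · exact ha ⟨hy.1, h⟩
    · exact hb ⟨h, hy.2⟩
  -- Both ends are strictly inside (0,1), thanks to `hl` and `hr`; the limits at 0 and 1 need not
  -- lie in the postcritical closure.
  have ha01 : a ∈ Ioo (0 : ℝ) 1 := ⟨hp.1.trans_le hpa, hax.trans hx01.2⟩
  have hb01 : b ∈ Ioo (0 : ℝ) 1 := ⟨hx01.1.trans hxb, hbq.trans_lt hq.2⟩
  obtain ⟨A, hA, hAt⟩ := hf.exists_tendsto_of_notMem_iterDomain (n := n)
    (add_I_mem_lateralPoints ⟨ha01.1.le, ha01.2⟩) (by simpa using ha01) (by simpa using haU)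
  obtain ⟨B, hB, hBt⟩ := hf.exists_tendsto_of_notMem_iterDomain (n := n)
    (sub_I_mem_lateralPoints ⟨hb01.1, hb01.2.le⟩) (by simpa using hb01) (by simpa using hbU)
  rw [lateralNhds_add_I] at hAt
  rw [lateralNhds_sub_I] at hBt
  refine ⟨a, b, hax, hxb, haU, hbU, hsub, ?_⟩
  obtain ⟨h1, h2, h3, H'⟩ := hf.exists_negSchwarzianOn_iterate hn
  have H := H'.mono hsub
  have hxm : x ∈ Ioo a b := ⟨hax, hxb⟩
  have evA : ∀ᶠ y in 𝓝[>] a, y ∈ Ioo a b ∧ y < x := by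
    filter_upwards [Ioo_mem_nhdsGT hax] with y hy using ⟨⟨hy.1, hy.2.trans hxb⟩, hy.2⟩
  have evB : ∀ᶠ y in 𝓝[<] b, y ∈ Ioo a b ∧ x < y := by
    filter_upwards [Ioo_mem_nhdsLT hxb] with y hy using ⟨⟨hax.trans hy.1, hy.2⟩, hy.1⟩
  have hlow : ∀ {D : ℝ}, D ∈ postcriticalClosure f C → D ≤ f^[n] x → D < u := fun hD h => by
    by_contra! hc
    exact hV _ ⟨hc, h.trans hxu.2⟩ hD
  have hhigh : ∀ {D : ℝ}, D ∈ postcriticalClosure f C → f^[n] x ≤ D → v < D := fun hD h => by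
    by_contra! hc
    exact hV _ ⟨hxu.1.trans h, hc⟩ hD
  have fin : ∀ s ∈ Ioo a b, ∀ t ∈ Ioo a b, f^[n] s < u → v < f^[n] t →
      Icc u v ⊆ f^[n] '' Ioo a b := fun s hs t ht hsu htv =>
    (Icc_subset_Icc hsu.le htv.le).trans
      (isPreconnected_Ioo.intermediate_value hs ht H.continuousOn)
  rcases H.strictMonoOn_or_strictAntiOn (convex_Ioo _ _) with hm | hm
  · have hAu : A < u := hlow hA (le_of_tendsto hAt (evA.mono fun y hy => (hm hy.1 hxm hy.2).le))
    have hBv : v < B := hhigh hB (ge_of_tendsto hBt (evB.mono fun y hy => (hm hxm hy.1 hy.2).le))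
    obtain ⟨s, hs, hsu⟩ := (evA.and (hAt.eventually (gt_mem_nhds hAu))).exists
    obtain ⟨t, ht, htv⟩ := (evB.and (hBt.eventually (lt_mem_nhds hBv))).exists
    exact fin s hs.1 t ht.1 hsu htv
  · have hAv : v < A := hhigh hA (ge_of_tendsto hAt (evA.mono fun y hy => (hm hy.1 hxm hy.2).le))
    have hBu : B < u := hlow hB (le_of_tendsto hBt (evB.mono fun y hy => (hm hxm hy.1 hy.2).le))
    obtain ⟨s, hs, hsu⟩ := (evB.and (hBt.eventually (gt_mem_nhds hBu))).exists
    obtain ⟨t, ht, htv⟩ := (evA.and (hAt.eventually (lt_mem_nhds hAv))).exists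
    exact fin s hs.1 t ht.1 hsu htv

/-- Uniform distortion bounds for the branches of the iterates of `f` over an interval that is well
inside the complement of the closure of the orbits of the lateral exceptional points. -/
theorem exists_bounded_distortion (hf : IsPiecewiseNegSchwarzian f C) {u' u v v' : ℝ}
    (hu : u' < u) (hv : v < v') (hV : ∀ y ∈ Icc u' v', y ∉ postcriticalClosure f C) :
    ∃ K > 0, ∀ n, 1 ≤ n → ∀ x ∈ iterDomain f C n, ¬ Ioc 0 x ⊆ iterDomain f C n →
      ¬ Ico x 1 ⊆ iterDomain f C n → f^[n] x ∈ Icc u v →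
      ∃ a b, a < x ∧ x < b ∧ a ∉ iterDomain f C n ∧ b ∉ iterDomain f C n ∧
        Ioo a b ⊆ iterDomain f C n ∧ Icc u v ⊆ f^[n] '' Ioo a b ∧
        ∀ p ∈ Ioo a b, ∀ q ∈ Ioo a b, ∀ r ∈ Ioo a b, ∀ s ∈ Ioo a b,
          f^[n] p ∈ Icc u v → f^[n] q ∈ Icc u v → f^[n] r ∈ Icc u v → f^[n] s ∈ Icc u v →
          |f^[n] p - f^[n] q| * |r - s| ≤ K * (|f^[n] r - f^[n] s| * |p - q|) := by
  -- The Koebe constant depends on the four end points alone, not on `n` or on the branch; the 1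
  -- only ensures positivity.
  set M := max (max ((v - u') / (u - u')) ((v' - u) / (v' - v))) 1
  have M1 : (v - u') / (u - u') ≤ M := (le_max_left _ _).trans (le_max_left _ _)
  have M2 : (v' - u) / (v' - v) ≤ M := (le_max_right _ _).trans (le_max_left _ _)
  have M0 : 0 < M := one_pos.trans_le (le_max_right _ _)
  refine ⟨M ^ 2, by positivity, fun n hn x hx hl hr hxu => ?_⟩
  obtain ⟨a, b, hax, hxb, ha, hb, hsub, him⟩ := hf.exists_Icc_subset_image hn hx hl hr hV
    ⟨hu.le.trans hxu.1, hxu.2.trans hv.le⟩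
  obtain ⟨h1, h2, h3, H⟩ := hf.exists_negSchwarzianOn_iterate hn
  have huv := hxu.1.trans hxu.2
  refine ⟨a, b, hax, hxb, ha, hb, hsub, (Icc_subset_Icc hu.le hv.le).trans him,
    fun p hp q hq r hr s hs hpu hqu hru hsu => ?_⟩
  exact (H.mono hsub).distortion (convex_Ioo _ _) hu hv ((div_le_iff₀ (sub_pos.2 hu)).1 M1)
    ((div_le_iff₀ (sub_pos.2 hv)).1 M2) (him ⟨le_rfl, by linarith⟩) (him ⟨by linarith, le_rfl⟩)
    hp hq hr hs hpu hqu hru hsu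

/-! ### Orbits in the interior of the survivor set -/

/-- A local diffeomorphism is open, so it carries a neighbourhood inside the survivor set to
another. -/
theorem mapsTo_interior_survivorSet (hf : IsPiecewiseNegSchwarzian f C) :
    MapsTo f (interior (survivorSet f C)) (interior (survivorSet f C)) := by
  intro x hx
  have hxD : x ∈ regularSet C := interior_subset hx 0
  have H := hf.negSchwarzianOn
  have hs : HasStrictDerivAt f (deriv f x) x := by
    refine hasStrictDerivAt_of_hasDerivAt_of_continuousAt ?_ (H.hasDerivAt_one x hxD).continuousAt
    filter_upwards [hf.isOpen_regularSet.mem_nhds hxD] with y hy using H.hasDerivAt y hy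
  rw [mem_interior_iff_mem_nhds] at hx ⊢
  rw [← hs.map_nhds_eq (H.ne_zero x hxD)]
  exact mem_map.2 (mem_of_superset hx fun y hy => iterate_mem_survivorSet hy 1)

theorem iterate_mapsTo_interior (hf : IsPiecewiseNegSchwarzian f C) (n : ℕ) :
    MapsTo f^[n] (interior (survivorSet f C)) (interior (survivorSet f C)) :=
  hf.mapsTo_interior_survivorSet.iterate n

theorem exists_not_Ioc_subset {x : ℝ} (hx : x ∈ interior (survivorSet f C))
    (hl : ¬ Ioc 0 x ⊆ interior (survivorSet f C)) : ∃ N, ¬ Ioc 0 x ⊆ iterDomain f C N := by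
  by_contra! hc
  have h : Ioo 0 x ⊆ interior (survivorSet f C) := interior_maximal
    (fun y hy => mem_survivorSet_of_forall fun n => hc n (Ioo_subset_Ioc_self hy)) isOpen_Ioo
  refine hl fun y hy => ?_
  rcases hy.2.eq_or_lt with rfl | hlt
  · exact hx
  · exact h ⟨hy.1, hlt⟩

theorem exists_not_Ico_subset {x : ℝ} (hx : x ∈ interior (survivorSet f C))
    (hl : ¬ Ico x 1 ⊆ interior (survivorSet f C)) : ∃ N, ¬ Ico x 1 ⊆ iterDomain f C N := by
  by_contra! hc
  have h : Ioo x 1 ⊆ interior (survivorSet f C) := interior_maximal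
    (fun y hy => mem_survivorSet_of_forall fun n => hc n (Ioo_subset_Ico_self hy)) isOpen_Ioo
  refine hl fun y hy => ?_
  rcases hy.1.eq_or_lt with rfl | hlt
  · exact hx
  · exact h ⟨hlt, hy.2⟩

/-- The orbit of an interior point of the survivor set that accumulates outside the closure of the
orbits of the lateral exceptional points visits some component of this interior twice. -/
theorem exists_uIcc_subset_of_not_subset (hf : IsPiecewiseNegSchwarzian f C) {x p : ℝ}
    (hx : x ∈ interior (survivorSet f C)) (hl : ¬ Ioc 0 x ⊆ interior (survivorSet f C))
    (hr : ¬ Ico x 1 ⊆ interior (survivorSet f C)) (hp : p ∉ postcriticalClosure f C)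
    (hxp : MapClusterPt p atTop fun n => f^[n] x) :
    ∃ i j, i < j ∧ uIcc (f^[i] x) (f^[j] x) ⊆ interior (survivorSet f C) := by
  obtain ⟨N1, hN1⟩ := exists_not_Ioc_subset hx hl
  obtain ⟨N2, hN2⟩ := exists_not_Ico_subset hx hr
  obtain ⟨ε, hε, hball⟩ := Metric.isOpen_iff.1 hf.isClosed_postcriticalClosure.isOpen_compl p hp
  rw [Real.ball_eq_Ioo] at hball
  have hV : ∀ y ∈ Icc (p - 3 / 4 * ε) (p + 3 / 4 * ε), y ∉ postcriticalClosure f C := fun y hy =>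
    hball ⟨by linarith [hy.1], by linarith [hy.2]⟩
  obtain ⟨K, hK, hdist⟩ := hf.exists_bounded_distortion (u := p - ε / 2) (v := p + ε / 2)
    (by linarith) (by linarith) hV
  obtain ⟨δ, hδ, hsub⟩ := Metric.isOpen_iff.1 isOpen_interior x hx
  rw [Real.ball_eq_Ioo] at hsub
  set y1 := x - δ / 2 with hy1
  set y2 := x + δ / 2 with hy2
  have hIcc : Icc y1 y2 ⊆ interior (survivorSet f C) := fun y hy =>
    hsub ⟨by linarith [hy.1], by linarith [hy.2]⟩
  -- For `f^[n] x` within `ε / 4` of `p`, the image of a point at distance `δ / 2` from `x` either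
  -- leaves the window of radius `ε / 2` (hence `ε / 4`), or stays in it. Then the distortion bound
  -- applies, the preimage of the window having length at most 1.
  set c := min (ε / 4) (ε * (δ / 2) / K) with hc
  have hc0 : 0 < c := by positivity
  have key : ∀ n, 1 ≤ n → N1 ≤ n → N2 ≤ n → f^[n] x ∈ Icc (p - ε / 4) (p + ε / 4) →
      Ioo (f^[n] x - c) (f^[n] x + c) ⊆ interior (survivorSet f C) := by
    intro n hn hn1 hn2 hxn
    have hKn : Icc y1 y2 ⊆ iterDomain f C n := hIcc.trans (interior_subset.trans survivorSet_subset)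
    obtain ⟨a, b, hax, hxb, ha, hb, hab, him, hd⟩ := hdist n hn x
      (survivorSet_subset (interior_subset hx))
      (fun h => hN1 (h.trans (iterDomain_anti hn1))) (fun h => hN2 (h.trans (iterDomain_anti hn2)))
      ⟨by linarith [hxn.1], by linarith [hxn.2]⟩
    have hay : Icc y1 y2 ⊆ Ioo a b := fun y hy => by
      constructor
      · by_contra! h
        exact ha (hKn ⟨hy.1.trans h, by linarith⟩)
      · by_contra! h
        exact hb (hKn ⟨by linarith, h.trans hy.2⟩)
    have hxm : x ∈ Icc y1 y2 := ⟨by linarith, by linarith⟩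
    have hy1m : y1 ∈ Icc y1 y2 := ⟨le_rfl, by linarith⟩
    have hy2m : y2 ∈ Icc y1 y2 := ⟨by linarith, le_rfl⟩
    have ha0 : 0 ≤ a := by
      by_contra! h
      exact lt_irrefl _ (iterDomain_subset_Ioo hn
        (hab ⟨h, (iterDomain_subset_Ioo hn (hKn hxm)).1.trans hxb⟩)).1
    have hb1 : b ≤ 1 := by
      by_contra! h
      exact lt_irrefl _ (iterDomain_subset_Ioo hn
        (hab ⟨hax.trans (iterDomain_subset_Ioo hn (hKn hxm)).2, h⟩)).2
    have far : ∀ y ∈ Icc y1 y2, |y - x| = δ / 2 → c ≤ |f^[n] y - f^[n] x| := by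
      intro y hy hyx
      by_cases hyu : f^[n] y ∈ Icc (p - ε / 2) (p + ε / 2)
      · obtain ⟨s, hs, es⟩ := him (left_mem_Icc.2 (by linarith))
        obtain ⟨t, ht, et⟩ := him (right_mem_Icc.2 (by linarith))
        have := hd t ht s hs y (hay hy) x (hay hxm) (et ▸ right_mem_Icc.2 (by linarith))
          (es ▸ left_mem_Icc.2 (by linarith)) hyu ⟨by linarith [hxn.1], by linarith [hxn.2]⟩
        rw [es, et, hyx, show p + ε / 2 - (p - ε / 2) = ε by ring, abs_of_pos hε] at this
        have hst : |t - s| ≤ 1 := abs_le.2 ⟨by linarith [hs.2, ht.1], by linarith [hs.1, ht.2]⟩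
        have h3 : K * (|f^[n] y - f^[n] x| * |t - s|) ≤ K * (|f^[n] y - f^[n] x| * 1) := by gcongr
        refine (min_le_right _ _).trans ((div_le_iff₀ hK).2 ?_)
        linarith
      · refine (min_le_left _ _).trans ?_
        by_contra! hlt
        have := abs_lt.1 hlt
        exact hyu ⟨by linarith [hxn.1], by linarith [hxn.2]⟩
    have f1 := far y1 hy1m (by rw [hy1, abs_of_neg] <;> linarith)
    have f2 := far y2 hy2m (by rw [hy2, abs_of_pos] <;> linarith)
    obtain ⟨h1, h2, h3, H'⟩ := hf.exists_negSchwarzianOn_iterate hn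
    have H := H'.mono hKn
    have fin : ∀ s ∈ Icc y1 y2, ∀ t ∈ Icc y1 y2, f^[n] s ≤ f^[n] x - c → f^[n] x + c ≤ f^[n] t →
        Ioo (f^[n] x - c) (f^[n] x + c) ⊆ interior (survivorSet f C) := by
      intro s hs t ht hsc htc y hy
      obtain ⟨z, hz, rfl⟩ := isPreconnected_Icc.intermediate_value hs ht H.continuousOn
        ⟨hsc.trans hy.1.le, hy.2.le.trans htc⟩
      exact hf.iterate_mapsTo_interior n (hIcc hz)
    rcases H.strictMonoOn_or_strictAntiOn (convex_Icc _ _) with hm | hm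
    · have g1 := hm hy1m hxm (by linarith)
      have g2 := hm hxm hy2m (by linarith)
      rw [abs_of_neg (by linarith)] at f1
      rw [abs_of_pos (by linarith)] at f2
      exact fin y1 hy1m y2 hy2m (by linarith) (by linarith)
    · have g1 := hm hy1m hxm (by linarith)
      have g2 := hm hxm hy2m (by linarith)
      rw [abs_of_pos (by linarith)] at f1
      rw [abs_of_neg (by linarith)] at f2
      exact fin y2 hy2m y1 hy1m (by linarith) (by linarith)
  -- Two late visits to the ball of radius `c / 2` around `p` are less than `c` apart, so the
  -- interval between them lies in the ball supplied by `key`.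
  have hfreq := hxp.frequently (Ioo_mem_nhds (show p - c / 2 < p by linarith)
    (show p < p + c / 2 by linarith))
  rw [frequently_atTop] at hfreq
  obtain ⟨i, hi, hxi⟩ := hfreq (max 1 (max N1 N2))
  obtain ⟨j, hj, hxj⟩ := hfreq (i + 1)
  simp only [max_le_iff] at hi
  have hcε : c ≤ ε / 4 := min_le_left _ _
  refine ⟨i, j, hj, fun y hy => key i hi.1 hi.2.1 hi.2.2
    ⟨by linarith [hxi.1], by linarith [hxi.2]⟩ ?_⟩
  have h1 := hxi.1; have h2 := hxi.2; have h3 := hxj.1; have h4 := hxj.2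
  rcases mem_uIcc.1 hy with hy | hy <;> exact ⟨by linarith [hy.1, hy.2], by linarith [hy.1, hy.2]⟩

theorem mapClusterPt_iterate {x y : ℝ} {i : ℕ} :
    MapClusterPt y atTop (fun n => f^[n] (f^[i] x)) ↔ MapClusterPt y atTop fun n => f^[n] x := by
  have : (fun n => f^[n] (f^[i] x)) = (fun n => f^[n] x) ∘ (· + i) := by
    ext n; simp [Function.iterate_add_apply]
  rw [this, MapClusterPt, MapClusterPt, ← Filter.map_map, map_add_atTop_eq_nat]

/-- If no iterate lies in a component reaching neither 0 nor 1, then each lies in a component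
adjacent to one of these two ends, and two of the iterates 0, 1, 2 share an end. -/
theorem exists_uIcc_subset (hf : IsPiecewiseNegSchwarzian f C) {x p : ℝ}
    (hx : x ∈ interior (survivorSet f C)) (hp : p ∉ postcriticalClosure f C)
    (hxp : MapClusterPt p atTop fun n => f^[n] x) :
    ∃ i j, i < j ∧ uIcc (f^[i] x) (f^[j] x) ⊆ interior (survivorSet f C) := by
  by_cases h : ∃ i, ¬ Ioc 0 (f^[i] x) ⊆ interior (survivorSet f C) ∧
      ¬ Ico (f^[i] x) 1 ⊆ interior (survivorSet f C)
  · obtain ⟨k, hk1, hk2⟩ := h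
    obtain ⟨i, j, hij, h⟩ := hf.exists_uIcc_subset_of_not_subset
      (hf.iterate_mapsTo_interior k hx) hk1 hk2 hp (mapClusterPt_iterate.2 hxp)
    simp only [← Function.iterate_add_apply] at h
    exact ⟨i + k, j + k, by omega, h⟩
  · have hmem : ∀ i, f^[i] x ∈ Ioo (0 : ℝ) 1 := fun i => (interior_subset hx i).1
    have two : ∀ i j, (Ioc 0 (f^[i] x) ⊆ interior (survivorSet f C) ↔
        Ioc 0 (f^[j] x) ⊆ interior (survivorSet f C)) →
        uIcc (f^[i] x) (f^[j] x) ⊆ interior (survivorSet f C) := by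
      intro i j hij y hy
      have hi := hmem i
      have hj := hmem j
      by_cases h0 : Ioc 0 (f^[i] x) ⊆ interior (survivorSet f C)
      · have h1 := hij.1 h0
        rcases mem_uIcc.1 hy with hy | hy
        · exact h1 ⟨hi.1.trans_le hy.1, hy.2⟩
        · exact h0 ⟨hj.1.trans_le hy.1, hy.2⟩
      · have h1 := fun h => h0 (hij.2 h)
        have h0' : Ico (f^[i] x) 1 ⊆ interior (survivorSet f C) := by
          by_contra hc; exact h ⟨i, h0, hc⟩
        have h1' : Ico (f^[j] x) 1 ⊆ interior (survivorSet f C) := by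
          by_contra hc; exact h ⟨j, h1, hc⟩
        rcases mem_uIcc.1 hy with hy | hy
        · exact h0' ⟨hy.1, hy.2.trans_lt hj.2⟩
        · exact h1' ⟨hy.1, hy.2.trans_lt hi.2⟩
    by_cases h01 : (Ioc 0 (f^[0] x) ⊆ interior (survivorSet f C) ↔
        Ioc 0 (f^[1] x) ⊆ interior (survivorSet f C))
    · exact ⟨0, 1, by norm_num, two 0 1 h01⟩
    by_cases h02 : (Ioc 0 (f^[0] x) ⊆ interior (survivorSet f C) ↔
        Ioc 0 (f^[2] x) ⊆ interior (survivorSet f C))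
    · exact ⟨0, 2, by norm_num, two 0 2 h02⟩
    exact ⟨1, 2, by norm_num, two 1 2 (by tauto)⟩

end IsPiecewiseNegSchwarzian

/-! ### Monotone convergence to periodic-like attractors -/

/-- The limit `q` of the increasing orbit of `z` may lie outside `G`, where `F` need not be
continuous, hence the one-sided formulation. All of `[z, q)` is attracted, by comparison with the
orbit of `z`; this will be the set of positive measure. -/
theorem StrictMonoOn.exists_tendsto_iterate_of_lt {F : ℝ → ℝ} {G : Set ℝ} (hG : G.OrdConnected)
    (hm : MapsTo F G G) (hF : StrictMonoOn F G) {z B : ℝ} (hz : z ∈ G) (hlt : z < F z)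
    (hB : ∀ x ∈ G, x ≤ B) : ∃ q, z < q ∧ q ≤ B ∧
      ∀ w ∈ Ico z q, w ∈ G ∧ Tendsto (fun k => F^[k] w) atTop (𝓝[<] q) := by
  have hmem : ∀ k, F^[k] z ∈ G := fun k => hm.iterate k hz
  have hmono : StrictMono fun k => F^[k] z := by
    refine strictMono_nat_of_lt_succ fun k => ?_
    induction k with
    | zero => exact hlt
    | succ k ih =>
      simp only [Function.iterate_succ_apply'] at ih ⊢
      exact hF (hmem k) (hm (hmem k)) ih
  have hbdd : BddAbove (range fun k => F^[k] z) :=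
    ⟨B, by rintro _ ⟨k, rfl⟩; exact hB _ (hmem k)⟩
  have hlim := tendsto_atTop_ciSup hmono.monotone hbdd
  set q := ⨆ k, F^[k] z
  have hlt' : ∀ k, F^[k] z < q := fun k => (hmono k.lt_succ_self).trans_le (le_ciSup hbdd (k + 1))
  refine ⟨q, hlt' 0, ciSup_le fun k => hB _ (hmem k), fun w hw => ?_⟩
  obtain ⟨j, hj⟩ := (hlim.eventually (lt_mem_nhds hw.2)).exists
  have hwG : w ∈ G := hG.out hz (hmem j) ⟨hw.1, hj.le⟩
  have hit : ∀ k, StrictMonoOn F^[k] G := fun k => by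
    induction k with
    | zero => exact strictMonoOn_id
    | succ k ih => exact ih.comp hF hm
  have hw1 : ∀ k, F^[k] z ≤ F^[k] w := fun k => (hit k).monotoneOn hz hwG hw.1
  have hw2 : ∀ k, F^[k] w < q := fun k => by
    refine ((hit k) hwG (hmem j) hj).trans ?_
    rw [← Function.iterate_add_apply]
    exact hlt' _
  exact ⟨hwG, tendsto_nhdsWithin_iff.2 ⟨tendsto_of_tendsto_of_tendsto_of_le_of_le hlim
    tendsto_const_nhds hw1 fun k => (hw2 k).le, .of_forall hw2⟩⟩

theorem StrictMonoOn.exists_tendsto_iterate_of_gt {F : ℝ → ℝ} {G : Set ℝ} (hG : G.OrdConnected)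
    (hm : MapsTo F G G) (hF : StrictMonoOn F G) {z B : ℝ} (hz : z ∈ G) (hlt : F z < z)
    (hB : ∀ x ∈ G, B ≤ x) : ∃ q, q < z ∧ B ≤ q ∧
      ∀ w ∈ Ioc q z, w ∈ G ∧ Tendsto (fun k => F^[k] w) atTop (𝓝[>] q) := by
  have hmem : ∀ k, F^[k] z ∈ G := fun k => hm.iterate k hz
  have hmono : StrictAnti fun k => F^[k] z := by
    refine strictAnti_nat_of_succ_lt fun k => ?_
    induction k with
    | zero => exact hlt
    | succ k ih =>
      simp only [Function.iterate_succ_apply'] at ih ⊢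
      exact hF (hm (hmem k)) (hmem k) ih
  have hbdd : BddBelow (range fun k => F^[k] z) :=
    ⟨B, by rintro _ ⟨k, rfl⟩; exact hB _ (hmem k)⟩
  have hlim := tendsto_atTop_ciInf hmono.antitone hbdd
  set q := ⨅ k, F^[k] z
  have hlt' : ∀ k, q < F^[k] z := fun k => (ciInf_le hbdd (k + 1)).trans_lt (hmono k.lt_succ_self)
  refine ⟨q, hlt' 0, le_ciInf fun k => hB _ (hmem k), fun w hw => ?_⟩
  obtain ⟨j, hj⟩ := (hlim.eventually (gt_mem_nhds hw.1)).exists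
  have hwG : w ∈ G := hG.out (hmem j) hz ⟨hj.le, hw.2⟩
  have hit : ∀ k, StrictMonoOn F^[k] G := fun k => by
    induction k with
    | zero => exact strictMonoOn_id
    | succ k ih => exact ih.comp hF hm
  have hw1 : ∀ k, F^[k] w ≤ F^[k] z := fun k => (hit k).monotoneOn hwG hz hw.2
  have hw2 : ∀ k, q < F^[k] w := fun k => by
    refine lt_trans ?_ ((hit k) (hmem j) hwG hj)
    rw [← Function.iterate_add_apply]
    exact hlt' _
  exact ⟨hwG, tendsto_nhdsWithin_iff.2 ⟨tendsto_of_tendsto_of_tendsto_of_le_of_le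
    tendsto_const_nhds hlim (fun k => (hw2 k).le) hw1, .of_forall hw2⟩⟩

theorem omegaSet_iterate {f : ℝ → ℝ} {C : Set ℝ} {x : ℝ} (hx : x ∈ survivorSet f C) (i : ℕ) :
    omegaSet f C (f^[i] x) = omegaSet f C x := by
  ext y
  simp only [omegaSet, mem_ofPred_eq, IsPiecewiseNegSchwarzian.mapClusterPt_iterate,
    IsPiecewiseNegSchwarzian.notMem_preorbit hx,
    IsPiecewiseNegSchwarzian.notMem_preorbit (iterate_mem_survivorSet hx i)]

theorem re_image_lateralOrbit {f : ℝ → ℝ} {α : ℂ} {m : ℕ} (hm : 1 ≤ m)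
    (hper : (lateralStep f)^[m] α = α) :
    Complex.re '' lateralOrbit f α =
      (fun r => ((lateralStep f)^[r] α).re) '' (Finset.range m : Set ℕ) := by
  ext y
  constructor
  · rintro ⟨_, ⟨n, rfl⟩, rfl⟩
    refine ⟨n % m, by simpa using Nat.mod_lt n hm, ?_⟩
    have hp : Function.IsPeriodicPt (lateralStep f) m α := hper
    simp only [hp.iterate_mod_apply]
  · rintro ⟨r, -, rfl⟩
    exact ⟨_, ⟨r, rfl⟩, rfl⟩

namespace IsPiecewiseNegSchwarzian

variable {f : ℝ → ℝ} {C : Set ℝ}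

theorem omegaSet_eq_of_tendsto (hf : IsPiecewiseNegSchwarzian f C) {α : ℂ}
    (hα : α ∈ lateralPoints) {m : ℕ} (hm : 1 ≤ m) {w : ℝ}
    (hw : w ∈ survivorSet f C) (ht : Tendsto (fun k => (f^[m])^[k] w) atTop (lateralNhds α)) :
    omegaSet f C w = Complex.re '' lateralOrbit f α := by
  have hlim : ∀ r, Tendsto (fun k => f^[r] ((f^[m])^[k] w)) atTop
      (𝓝 ((lateralStep f)^[r] α).re) := fun r =>
    ((hf.tendsto_iterate_lateralStep hα r).2.mono_right (lateralNhds_le_nhds _)).comp ht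
  have hiter : ∀ r k, f^[r] ((f^[m])^[k] w) = f^[r + m * k] w := fun r k => by
    rw [← Function.iterate_mul, ← Function.iterate_add_apply]
  simp only [hiter] at hlim
  ext y
  constructor
  · rintro ⟨-, hy⟩
    -- Along an ultrafilter the residue of `n` modulo `m` is constant, so only one of the `m` limits
    -- can occur.
    obtain ⟨U, hU, hUy⟩ := mapClusterPt_iff_ultrafilter.1 hy
    have hmod : ∀ᶠ n in (U : Filter ℕ), ∃ r ∈ (Finset.range m : Set ℕ), n % m = r :=
      .of_forall fun n => ⟨n % m, by simpa using Nat.mod_lt n hm, rfl⟩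
    rw [Ultrafilter.eventually_exists_mem_iff (Finset.finite_toSet _)] at hmod
    obtain ⟨r, -, hr⟩ := hmod
    have hdiv : Tendsto (fun n => n / m) (U : Filter ℕ) atTop :=
      (Nat.tendsto_div_const_atTop (by omega)).mono_left hU
    have h2 : Tendsto (fun n => f^[n] w) (U : Filter ℕ) (𝓝 ((lateralStep f)^[r] α).re) := by
      refine ((hlim r).comp hdiv).congr' ?_
      filter_upwards [hr] with n hn
      simp only [Function.comp, ← hn, Nat.mod_add_div]
    exact ⟨_, ⟨r, rfl⟩, (tendsto_nhds_unique hUy h2).symm⟩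
  · rintro ⟨_, ⟨r, rfl⟩, rfl⟩
    refine ⟨notMem_preorbit hw, ?_⟩
    have hφ : Tendsto (fun k => r + m * k) atTop atTop :=
      tendsto_atTop_mono (fun k => (Nat.le_mul_of_pos_left k hm).trans (Nat.le_add_left _ r)) tendsto_id
    exact MapClusterPt.of_comp (u := fun n => f^[n] w) hφ (hlim r).mapClusterPt

/-- A periodic lateral point whose orbit attracts a set of positive measure gives a periodic-like
attractor. -/
theorem mem_periodicLikeBasins (hf : IsPiecewiseNegSchwarzian f C) {α : ℂ}
    (hα : α ∈ lateralPoints) {m : ℕ} (hm : 1 ≤ m) (hper : (lateralStep f)^[m] α = α)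
    {E : Set ℝ} (hE : 0 < volume E) (hEs : E ⊆ survivorSet f C)
    (hEt : ∀ w ∈ E, Tendsto (fun k => (f^[m])^[k] w) atTop (lateralNhds α)) {x : ℝ}
    (hx : x ∈ survivorSet f C) (hxo : omegaSet f C x = Complex.re '' lateralOrbit f α) :
    x ∈ periodicLikeBasins f C := by
  have hI : ∀ {y}, y ∈ survivorSet f C → y ∈ Icc (0 : ℝ) 1 := fun hy =>
    Ioo_subset_Icc_self (hy 0).1
  have hEo : ∀ w ∈ E, omegaSet f C w = Complex.re '' lateralOrbit f α := fun w hw =>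
    hf.omegaSet_eq_of_tendsto hα hm (hEs hw) (hEt w hw)
  have hEb : E ⊆ attractionBasin f C (Complex.re '' lateralOrbit f α) := fun w hw =>
    ⟨hI (hEs hw), (hEo w hw).le⟩
  refine ⟨Complex.re '' lateralOrbit f α, ⟨?_, ?_, hE.trans_le (measure_mono hEb), ?_⟩,
    ⟨α, hα, ⟨m, hm, hper⟩, rfl⟩, hI hx, hxo.le⟩
  · rw [re_image_lateralOrbit hm hper]
    exact ((Finset.finite_toSet _).image _).isCompact
  · rintro _ ⟨_, ⟨n, rfl⟩, rfl⟩
    exact re_mem_of_mem_lateralPoints (hf.tendsto_iterate_lateralStep hα n).1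
  -- Each point of `E` has the whole orbit as omega limit set, so none is in the basin of the
  -- smaller `A'`, and the two basins differ on `E`.
  · intro A' _ hA' heq
    refine hE.ne' (measure_mono_null (fun w hw => ?_) (ae_iff.1 heq))
    intro hc
    have hw' : w ∈ attractionBasin f C A' := (Eq.to_iff hc.symm).1 (hEb hw)
    exact hA'.2 ((hEo w hw).symm.le.trans hw'.2)

/-- `f^[p]` may reverse orientation; its square does not. -/
theorem iterate_strictMonoOn_two_mul (hf : IsPiecewiseNegSchwarzian f C) {p : ℕ} (hp : 1 ≤ p)
    {G : Set ℝ} (hG : Convex ℝ G) (hsub : G ⊆ survivorSet f C) (hm : MapsTo f^[p] G G) :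
    StrictMonoOn f^[2 * p] G := by
  obtain ⟨h1, h2, h3, H⟩ := hf.exists_negSchwarzianOn_iterate hp
  rw [two_mul, Function.iterate_add]
  rcases (H.mono (hsub.trans survivorSet_subset)).strictMonoOn_or_strictAntiOn hG with h | h
  · exact h.comp h hm
  · exact h.comp h hm

/-- An orbit that visits some component of the interior of the survivor set twice is attracted to a
periodic-like attractor, unless it is preperiodic. -/
theorem mem_periodicLikeBasins_of_uIcc_subset (hf : IsPiecewiseNegSchwarzian f C) {x : ℝ}
    (hx : x ∈ interior (survivorSet f C)) {i p : ℕ} (hp : 1 ≤ p)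
    (hsub : uIcc (f^[i] x) (f^[i + p] x) ⊆ interior (survivorSet f C))
    (hne : f^[i + 2 * p] x ≠ f^[i] x) : x ∈ periodicLikeBasins f C := by
  set z := f^[i] x with hz
  have e1 : f^[i + p] x = f^[p] z := by rw [hz, ← Function.iterate_add_apply, add_comm]
  have e2 : f^[i + 2 * p] x = f^[2 * p] z := by rw [hz, ← Function.iterate_add_apply, add_comm]
  rw [e1] at hsub
  rw [e2] at hne
  have hzO : z ∈ interior (survivorSet f C) := hf.iterate_mapsTo_interior i hx
  set G := connectedComponentIn (interior (survivorSet f C)) z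
  have hGO : G ⊆ interior (survivorSet f C) := connectedComponentIn_subset _ _
  have hGs : G ⊆ survivorSet f C := hGO.trans interior_subset
  have hGp : IsPreconnected G := isPreconnected_connectedComponentIn
  have hzG : z ∈ G := mem_connectedComponentIn hzO
  have hpz : f^[p] z ∈ G :=
    isPreconnected_uIcc.subset_connectedComponentIn left_mem_uIcc hsub right_mem_uIcc
  have hmaps : MapsTo f^[p] G G := by
    have h1 : IsPreconnected (f^[p] '' G) :=
      hGp.image _ ((hf.continuousOn_iterate p).mono (hGs.trans survivorSet_subset))
    have h2 : f^[p] '' G ⊆ interior (survivorSet f C) := by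
      rintro _ ⟨y, hy, rfl⟩
      exact hf.iterate_mapsTo_interior p (hGO hy)
    have h3 := h1.subset_connectedComponentIn (mem_image_of_mem _ hzG) h2
    rw [← connectedComponentIn_eq hpz] at h3
    exact fun y hy => h3 (mem_image_of_mem _ hy)
  have hmaps2 : MapsTo f^[2 * p] G G := by
    rw [two_mul, Function.iterate_add]; exact hmaps.comp hmaps
  have hG01 : ∀ y ∈ G, y ∈ Ioo (0 : ℝ) 1 := fun y hy => (hGs hy 0).1
  have hmono := hf.iterate_strictMonoOn_two_mul hp hGp.ordConnected.convex hGs hmaps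
  have h2p : 1 ≤ 2 * p := by omega
  have fin : ∀ α ∈ lateralPoints, ∀ E : Set ℝ, 0 < volume E → E ⊆ G →
      (∀ w ∈ E, Tendsto (fun k => (f^[2 * p])^[k] w) atTop (lateralNhds α)) →
      Tendsto (fun k => (f^[2 * p])^[k] z) atTop (lateralNhds α) →
      x ∈ periodicLikeBasins f C := by
    intro α hα E hE hEG hEt hzt
    have hstep := hf.tendsto_iterate_lateralStep hα (2 * p)
    -- The shifted orbit converges both to the lateral image of `α` and to `α`.
    have hper : (lateralStep f)^[2 * p] α = α := by
      refine eq_of_tendsto_lateralNhds hstep.1 hα (hstep.2.comp hzt) ?_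
      refine (hzt.comp (tendsto_add_atTop_nat 1)).congr fun k => ?_
      simp only [Function.comp, Function.iterate_succ_apply']
    refine hf.mem_periodicLikeBasins hα h2p hper hE (hEG.trans hGs) hEt (interior_subset hx) ?_
    rw [← omegaSet_iterate (interior_subset hx) i]
    exact hf.omegaSet_eq_of_tendsto hα h2p (hGs hzG) hzt
  rcases hne.lt_or_gt with hlt | hlt
  · obtain ⟨q, hqz, hq0, hq⟩ := hmono.exists_tendsto_iterate_of_gt hGp.ordConnected hmaps2 hzG hlt
      fun y hy => (hG01 y hy).1.le
    have hz1 := (hG01 z hzG).2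
    refine fin _ (add_I_mem_lateralPoints ⟨hq0, hqz.trans hz1⟩) (Ioc q z) (by simpa using hqz)
      (fun w hw => (hq w hw).1) ?_ ?_ <;> rw [lateralNhds_add_I]
    · exact fun w hw => (hq w hw).2
    · exact (hq z ⟨hqz, le_rfl⟩).2
  · obtain ⟨q, hqz, hq0, hq⟩ := hmono.exists_tendsto_iterate_of_lt hGp.ordConnected hmaps2 hzG hlt
      fun y hy => (hG01 y hy).2.le
    have hz1 := (hG01 z hzG).1
    refine fin _ (sub_I_mem_lateralPoints ⟨hz1.trans hqz, hq0⟩) (Ico z q) (by simpa using hqz)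
      (fun w hw => (hq w hw).1) ?_ ?_ <;> rw [lateralNhds_sub_I]
    · exact fun w hw => (hq w hw).2
    · exact (hq z ⟨le_rfl, hqz⟩).2

end IsPiecewiseNegSchwarzian

/-! ### Countable exceptional sets -/

/-- Choose a rational just to the right of each such point. If two points shared it, the larger one
would be interior. -/
theorem countable_right_endpoints (K : Set ℝ) :
    {x | x ∉ interior K ∧ ∃ t, x < t ∧ Ioo x t ⊆ K}.Countable := by
  have hq : ∀ x : {x | x ∉ interior K ∧ ∃ t, x < t ∧ Ioo x t ⊆ K},
      ∃ q : ℚ, (x : ℝ) < q ∧ Ioc (x : ℝ) q ⊆ interior K := by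
    rintro ⟨x, -, t, hxt, ht⟩
    obtain ⟨q, hq1, hq2⟩ := exists_rat_btwn hxt
    exact ⟨q, hq1, fun y hy => interior_maximal ht isOpen_Ioo ⟨hy.1, hy.2.trans_lt hq2⟩⟩
  choose q hq1 hq2 using hq
  have hinj : Function.Injective q := by
    intro x y hxy
    rcases lt_trichotomy (x : ℝ) y with h | h | h
    · exact (y.2.1 (hq2 x ⟨h, hxy ▸ (hq1 y).le⟩)).elim
    · exact Subtype.ext h
    · exact (x.2.1 (hq2 y ⟨h, hxy ▸ (hq1 x).le⟩)).elim
  exact Set.countable_coe_iff.1 hinj.countable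

theorem countable_left_endpoints (K : Set ℝ) :
    {x | x ∉ interior K ∧ ∃ t, t < x ∧ Ioo t x ⊆ K}.Countable := by
  have hq : ∀ x : {x | x ∉ interior K ∧ ∃ t, t < x ∧ Ioo t x ⊆ K},
      ∃ q : ℚ, (q : ℝ) < x ∧ Ico (q : ℝ) x ⊆ interior K := by
    rintro ⟨x, -, t, hxt, ht⟩
    obtain ⟨q, hq1, hq2⟩ := exists_rat_btwn hxt
    exact ⟨q, hq2, fun y hy => interior_maximal ht isOpen_Ioo ⟨hq1.trans_le hy.1, hy.2⟩⟩
  choose q hq1 hq2 using hq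
  have hinj : Function.Injective q := by
    intro x y hxy
    rcases lt_trichotomy (x : ℝ) y with h | h | h
    · exact (x.2.1 (hq2 y ⟨hxy ▸ (hq1 x).le, h⟩)).elim
    · exact Subtype.ext h
    · exact (y.2.1 (hq2 x ⟨hxy ▸ (hq1 y).le, h⟩)).elim
  exact Set.countable_coe_iff.1 hinj.countable

theorem Set.Infinite.exists_four {α : Type*} [LinearOrder α] {A : Set α} (hA : A.Infinite) :
    ∃ x1 ∈ A, ∃ x2 ∈ A, ∃ x3 ∈ A, ∃ x4 ∈ A, x1 < x2 ∧ x2 < x3 ∧ x3 < x4 := by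
  obtain ⟨s, hs, hcard⟩ := hA.exists_subset_card_eq 4
  let e := s.orderEmbOfFin hcard
  have hm : ∀ i, e i ∈ A := fun i => hs (s.orderEmbOfFin_mem hcard i)
  exact ⟨e 0, hm 0, e 1, hm 1, e 2, hm 2, e 3, hm 3, e.strictMono (by decide),
    e.strictMono (by decide), e.strictMono (by decide)⟩

namespace IsPiecewiseNegSchwarzian

variable {f : ℝ → ℝ} {C : Set ℝ}

theorem iterate_strictMonoOn_or_strictAntiOn (hf : IsPiecewiseNegSchwarzian f C) (n : ℕ)
    {S : Set ℝ} (hS : Convex ℝ S) (hsub : S ⊆ iterDomain f C n) :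
    StrictMonoOn f^[n] S ∨ StrictAntiOn f^[n] S := by
  rcases Nat.eq_zero_or_pos n with rfl | hn
  · exact .inl strictMonoOn_id
  · obtain ⟨h1, h2, h3, H⟩ := hf.exists_negSchwarzianOn_iterate hn
    exact (H.mono hsub).strictMonoOn_or_strictAntiOn hS

/-- On an interval of survivors `f^[i]` is injective, and on its image `f^[q]` has at most three
fixed points if increasing (negative Schwarzian derivative) and at most one if decreasing. Countably
many rational intervals suffice. -/
theorem countable_preperiodic (hf : IsPiecewiseNegSchwarzian f C) (i : ℕ) {q : ℕ} (hq : 1 ≤ q) :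
    {x ∈ interior (survivorSet f C) | f^[q] (f^[i] x) = f^[i] x}.Countable := by
  have hfin : ∀ a b : ℝ, Ioo a b ⊆ interior (survivorSet f C) →
      {x ∈ Ioo a b | f^[q] (f^[i] x) = f^[i] x}.Finite := by
    intro a b hab
    have habs : Ioo a b ⊆ iterDomain f C i :=
      hab.trans (interior_subset.trans survivorSet_subset)
    by_contra hinf
    obtain ⟨x1, ⟨m1, e1⟩, x2, ⟨m2, e2⟩, x3, ⟨m3, e3⟩, x4, ⟨m4, e4⟩, h12, h23, h34⟩ :=
      Set.Infinite.exists_four hinf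
    set S := f^[i] '' Ioo a b with hSdef
    have hS : Convex ℝ S := (isPreconnected_Ioo.image _
      ((hf.continuousOn_iterate i).mono habs)).ordConnected.convex
    have hSs : S ⊆ iterDomain f C q := by
      rintro _ ⟨y, hy, rfl⟩
      exact survivorSet_subset (interior_subset (hf.iterate_mapsTo_interior i (hab hy)))
    obtain ⟨h1, h2, h3, H'⟩ := hf.exists_negSchwarzianOn_iterate hq
    have H := H'.mono hSs
    have four : ∀ t1 ∈ S, ∀ t2 ∈ S, ∀ t3 ∈ S, ∀ t4 ∈ S, f^[q] t1 = t1 → f^[q] t2 = t2 →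
        f^[q] t3 = t3 → f^[q] t4 = t4 → t1 < t2 → t2 < t3 → t3 < t4 → False := by
      intro t1 n1 t2 n2 t3 n3 t4 n4 g1 g2 g3 g4 l1 l2 l3
      rcases H.pos_or_neg hS.isPreconnected with hp | hn
      · exact H.not_four_fixed hS hp n1 n4 l1 l2 l3 g1 g2 g3 g4
      · have := H.neg_fun.strictMonoOn hS (fun x hx => neg_pos.2 (hn x hx)) n1 n2 l1
        simp only [g1, g2] at this
        linarith
    have hmem : ∀ {y}, y ∈ Ioo a b → f^[i] y ∈ S := fun hy => mem_image_of_mem _ hy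
    rcases hf.iterate_strictMonoOn_or_strictAntiOn i (convex_Ioo a b) habs with hm | hm
    · exact four _ (hmem m1) _ (hmem m2) _ (hmem m3) _ (hmem m4) e1 e2 e3 e4 (hm m1 m2 h12)
        (hm m2 m3 h23) (hm m3 m4 h34)
    · exact four _ (hmem m4) _ (hmem m3) _ (hmem m2) _ (hmem m1) e4 e3 e2 e1 (hm m3 m4 h34)
        (hm m2 m3 h23) (hm m1 m2 h12)
  have hsub : {x ∈ interior (survivorSet f C) | f^[q] (f^[i] x) = f^[i] x} ⊆
      ⋃ r : ℚ × ℚ, {x | Ioo (r.1 : ℝ) r.2 ⊆ interior (survivorSet f C) ∧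
        x ∈ Ioo (r.1 : ℝ) r.2 ∧ f^[q] (f^[i] x) = f^[i] x} := by
    rintro x ⟨hx, e⟩
    obtain ⟨δ, hδ, hball⟩ := Metric.isOpen_iff.1 isOpen_interior x hx
    rw [Real.ball_eq_Ioo] at hball
    obtain ⟨r1, hr1, hr1'⟩ := exists_rat_btwn (show x - δ < x by linarith)
    obtain ⟨r2, hr2, hr2'⟩ := exists_rat_btwn (show x < x + δ by linarith)
    exact mem_iUnion.2 ⟨(r1, r2), fun y hy => hball ⟨hr1.trans hy.1, hy.2.trans hr2'⟩,
      ⟨hr1', hr2⟩, e⟩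
  refine (countable_iUnion fun r => ?_).mono hsub
  by_cases h : Ioo (r.1 : ℝ) r.2 ⊆ interior (survivorSet f C)
  · exact (hfin _ _ h).countable.mono fun x hx => hx.2
  · exact countable_empty.mono fun x hx => h hx.1

/-! ### Shrinking domains and the density argument -/

/-- The components of the domains of the iterates of `f` around `x` shrink to `x`. -/
def DomainsShrink (f : ℝ → ℝ) (C : Set ℝ) (x : ℝ) : Prop :=
  ∀ ε > 0, ∃ n, ¬ Ioc (x - ε) x ⊆ iterDomain f C n ∧ ¬ Ico x (x + ε) ⊆ iterDomain f C n

theorem domainsShrink {x : ℝ}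
    (hr : ¬ ∃ t, x < t ∧ Ioo x t ⊆ survivorSet f C)
    (hl : ¬ ∃ t, t < x ∧ Ioo t x ⊆ survivorSet f C) : DomainsShrink f C x := by
  intro ε hε
  have h1 : ∃ n, ¬ Ioc (x - ε) x ⊆ iterDomain f C n := by
    by_contra! hc
    exact hl ⟨x - ε, by linarith, fun y hy =>
      mem_survivorSet_of_forall fun n => hc n (Ioo_subset_Ioc_self hy)⟩
  have h2 : ∃ n, ¬ Ico x (x + ε) ⊆ iterDomain f C n := by
    by_contra! hc
    exact hr ⟨x + ε, by linarith, fun y hy =>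
      mem_survivorSet_of_forall fun n => hc n (Ioo_subset_Ico_self hy)⟩
  obtain ⟨n, hn⟩ := h1
  obtain ⟨m, hm⟩ := h2
  exact ⟨max n m, fun h => hn (h.trans (iterDomain_anti (le_max_left _ _))),
    fun h => hm (h.trans (iterDomain_anti (le_max_right _ _)))⟩

/-- Almost every point around which the domains of the iterates shrink and whose orbit visits
`[u, v]` infinitely often also visits every subinterval of `[u, v]` infinitely often. -/
theorem volume_avoiding_eq_zero (hf : IsPiecewiseNegSchwarzian f C) {u' u v v' l₁ l₂ : ℝ}
    (hu : u' < u) (hv : v < v') (hV : ∀ y ∈ Icc u' v', y ∉ postcriticalClosure f C)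
    (hul : u ≤ l₁) (hl : l₁ < l₂) (hlv : l₂ ≤ v) (N : ℕ) :
    volume {x | x ∈ survivorSet f C ∧ DomainsShrink f C x ∧
      (∃ᶠ n in atTop, f^[n] x ∈ Icc u v) ∧ ∀ n ≥ N, f^[n] x ∉ Ioo l₁ l₂} = 0 := by
  set X := {x | x ∈ survivorSet f C ∧ DomainsShrink f C x ∧
      (∃ᶠ n in atTop, f^[n] x ∈ Icc u v) ∧ ∀ n ≥ N, f^[n] x ∉ Ioo l₁ l₂} with hX
  obtain ⟨K, hK, hdist⟩ := hf.exists_bounded_distortion hu hv hV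
  have huv : u < v := by linarith
  -- By bounded distortion, the preimage of `(l₁, l₂)` in a branch is at least `κ` times as long as
  -- that of `[u, v]`.
  set κ := (l₂ - l₁) / (K * (v - u)) with hκ
  have hκ0 : 0 < κ := div_pos (sub_pos.2 hl) (mul_pos hK (sub_pos.2 huv))
  -- Here `r` is the length of the preimage of `[u, v]` in the branch around `x`. This preimage
  -- contains `x`, so the gap pulled back from `(l₁, l₂)` lies within `r` of `x`; and `X` misses it
  -- because `n ≥ N`.
  have gap : ∀ x ∈ X, ∀ ε > 0, ∃ r m M, 0 < r ∧ r < ε ∧ x - r ≤ m ∧ m ≤ M ∧ M ≤ x + r ∧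
      κ * r ≤ M - m ∧ Disjoint X (Ioo m M) := by
    rintro x ⟨hxs, hsh, hfr, -⟩ ε hε
    have hx01 : x ∈ Ioo (0 : ℝ) 1 := (hxs 0).1
    have h0 := hx01.1
    have h1 := sub_pos.2 hx01.2
    -- The branch lies within `ε'` of `x`, so it has length less than `ε`; the bounds by `x` and `1
    -- - x` keep its ends in (0,1).
    set ε' := min (ε / 2) (min x (1 - x)) with hε'
    have hε'0 : 0 < ε' := by positivity
    have hb1 : ε' ≤ ε / 2 := min_le_left _ _
    have hb2 : ε' ≤ x := (min_le_right _ _).trans (min_le_left _ _)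
    have hb3 : ε' ≤ 1 - x := (min_le_right _ _).trans (min_le_right _ _)
    obtain ⟨n0, hn0, hn0'⟩ := hsh ε' hε'0
    obtain ⟨n, hn, hxn⟩ := frequently_atTop.1 hfr (max 1 (max N n0))
    simp only [max_le_iff] at hn
    obtain ⟨hn1, hnN, hnn0⟩ := hn
    have hL : ¬ Ioc (x - ε') x ⊆ iterDomain f C n := fun h => hn0 (h.trans (iterDomain_anti hnn0))
    have hR : ¬ Ico x (x + ε') ⊆ iterDomain f C n := fun h => hn0' (h.trans (iterDomain_anti hnn0))
    obtain ⟨a, b, hax, hxb, ha, hb, hab, him, hd⟩ := hdist n hn1 x (survivorSet_subset hxs)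
      (fun h => hL ((Ioc_subset_Ioc_left (by linarith)).trans h))
      (fun h => hR ((Ico_subset_Ico_right (by linarith)).trans h)) hxn
    have hxa : x - ε' < a := by
      obtain ⟨p, hp, hpn⟩ := not_subset.1 hL
      by_contra! hc
      exact hpn (hab ⟨hc.trans_lt hp.1, hp.2.trans_lt hxb⟩)
    have hxb' : b < x + ε' := by
      obtain ⟨p, hp, hpn⟩ := not_subset.1 hR
      by_contra! hc
      exact hpn (hab ⟨hax.trans_le hp.1, hp.2.trans_le hc⟩)
    have mu : u ∈ Icc u v := ⟨le_rfl, huv.le⟩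
    have mv : v ∈ Icc u v := ⟨huv.le, le_rfl⟩
    have m1 : l₁ ∈ Icc u v := ⟨hul, by linarith⟩
    have m2 : l₂ ∈ Icc u v := ⟨by linarith, hlv⟩
    obtain ⟨s, hs, es⟩ := him mu
    obtain ⟨t, ht, et⟩ := him mv
    obtain ⟨y1, hy1, e1⟩ := him m1
    obtain ⟨y2, hy2, e2⟩ := him m2
    have hdd := hd y1 hy1 y2 hy2 t ht s hs (e1 ▸ m1) (e2 ▸ m2) (et ▸ mv) (es ▸ mu)
    rw [e1, e2, es, et, abs_sub_comm l₁, abs_of_pos (sub_pos.2 hl), abs_of_pos (sub_pos.2 huv),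
      ← mul_assoc] at hdd
    have hκr : κ * |t - s| ≤ |y1 - y2| := by
      rw [hκ, div_mul_eq_mul_div, div_le_iff₀ (mul_pos hK (sub_pos.2 huv))]
      linarith
    have hst : s ≠ t := fun h => huv.ne (by rw [← es, ← et, h])
    have hr0 : 0 < |t - s| := abs_pos.2 (sub_ne_zero.2 hst.symm)
    have hrε : |t - s| < ε := abs_lt.2 ⟨by linarith [hs.2, ht.1], by linarith [hs.1, ht.2]⟩
    have hxm : x ∈ Ioo a b := ⟨hax, hxb⟩
    rcases hf.iterate_strictMonoOn_or_strictAntiOn n (convex_Ioo a b) hab with hm | hm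
    · have c1 : s ≤ y1 := (hm.le_iff_le hs hy1).1 (by rw [es, e1]; exact hul)
      have c2 : y1 < y2 := (hm.lt_iff_lt hy1 hy2).1 (by rw [e1, e2]; exact hl)
      have c3 : y2 ≤ t := (hm.le_iff_le hy2 ht).1 (by rw [et, e2]; exact hlv)
      have c4 : s ≤ x := (hm.le_iff_le hs hxm).1 (by rw [es]; exact hxn.1)
      have c5 : x ≤ t := (hm.le_iff_le hxm ht).1 (by rw [et]; exact hxn.2)
      have er : |t - s| = t - s := abs_of_nonneg (by linarith)
      rw [abs_of_neg (show y1 - y2 < 0 by linarith)] at hκr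
      refine ⟨|t - s|, y1, y2, hr0, hrε, by linarith, c2.le, by linarith, by linarith,
        disjoint_left.2 fun y hy hyy => hy.2.2.2 n hnN ?_⟩
      have hyab : y ∈ Ioo a b := ⟨hy1.1.trans hyy.1, hyy.2.trans hy2.2⟩
      exact ⟨e1 ▸ hm hy1 hyab hyy.1, e2 ▸ hm hyab hy2 hyy.2⟩
    · have c1 : y1 ≤ s := (hm.le_iff_ge hs hy1).1 (by rw [es, e1]; exact hul)
      have c2 : y2 < y1 := (hm.lt_iff_gt hy1 hy2).1 (by rw [e1, e2]; exact hl)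
      have c3 : t ≤ y2 := (hm.le_iff_ge hy2 ht).1 (by rw [et, e2]; exact hlv)
      have c4 : x ≤ s := (hm.le_iff_ge hs hxm).1 (by rw [es]; exact hxn.1)
      have c5 : t ≤ x := (hm.le_iff_ge hxm ht).1 (by rw [et]; exact hxn.2)
      have er : |t - s| = s - t := by rw [abs_sub_comm]; exact abs_of_nonneg (by linarith)
      rw [abs_of_pos (show 0 < y1 - y2 by linarith)] at hκr
      refine ⟨|t - s|, y2, y1, hr0, hrε, by linarith, c2.le, by linarith, by linarith,
        disjoint_left.2 fun y hy hyy => hy.2.2.2 n hnN ?_⟩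
      have hyab : y ∈ Ioo a b := ⟨hy2.1.trans hyy.1, hyy.2.trans hy1.2⟩
      exact ⟨e1 ▸ hm hyab hy1 hyy.2, e2 ▸ hm hy2 hyab hyy.1⟩
  -- This form of the density theorem needs no measurability of `X`. The gap bounds the density in
  -- the ball of radius `r` by `(2r - κr) / (2r) = 1 - κ / 2`.
  have hae := Besicovitch.ae_tendsto_measure_inter_div (volume : Measure ℝ) X
  rw [← Measure.restrict_apply_self]
  refine measure_mono_null ?_ (ae_iff.1 hae)
  intro x hx hlim
  have hlt : ENNReal.ofReal (1 - κ / 2) < 1 := by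
    rw [← ENNReal.ofReal_one]
    exact (ENNReal.ofReal_lt_ofReal_iff one_pos).2 (by linarith)
  have hev := hlim.eventually (lt_mem_nhds hlt)
  obtain ⟨ε, hε, hball⟩ := mem_nhdsGT_iff_exists_Ioo_subset.1 hev
  obtain ⟨r, m, M, hr0, hrε, hxm, hmM, hMx, hκr, hdisj⟩ := gap x hx ε hε
  have hlt2 : ENNReal.ofReal (1 - κ / 2) <
      volume (X ∩ Metric.closedBall x r) / volume (Metric.closedBall x r) := hball ⟨hr0, hrε⟩
  have hsub : Ioo m M ⊆ Metric.closedBall x r := by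
    rw [Real.closedBall_eq_Icc]
    exact fun y hy => ⟨hxm.trans hy.1.le, hy.2.le.trans hMx⟩
  have hle : volume (X ∩ Metric.closedBall x r) ≤ ENNReal.ofReal (2 * r - (M - m)) := by
    calc volume (X ∩ Metric.closedBall x r) ≤ volume (Metric.closedBall x r \ Ioo m M) :=
          measure_mono fun y hy => ⟨hy.2, disjoint_left.1 hdisj hy.1⟩
      _ = volume (Metric.closedBall x r) - volume (Ioo m M) :=
          measure_sdiff hsub measurableSet_Ioo.nullMeasurableSet (by simp)
      _ = _ := by
          rw [Real.volume_closedBall, Real.volume_Ioo, ← ENNReal.ofReal_sub _ (by linarith)]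
  have : volume (X ∩ Metric.closedBall x r) / volume (Metric.closedBall x r) ≤
      ENNReal.ofReal (1 - κ / 2) := by
    rw [Real.volume_closedBall]
    refine ENNReal.div_le_of_le_mul (hle.trans ?_)
    rw [mul_comm (ENNReal.ofReal _), ← ENNReal.ofReal_mul (by positivity)]
    exact ENNReal.ofReal_le_ofReal (by linarith)
  exact hlt2.not_ge this

end IsPiecewiseNegSchwarzian

/-! ### The main theorem -/

theorem mainTheorem6 (f : ℝ → ℝ) (C : Set ℝ) (hf : IsPiecewiseNegSchwarzian f C) :
    ∀ᵐ x ∂(volume : Measure ℝ),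
      x ∈ Icc (0 : ℝ) 1 \ (periodicLikeBasins f C ∪ intervalCycleBasins f C) →
        omegaSet f C x ⊆
          ⋃ α ∈ lateralExceptionalSet C, closure (Complex.re '' lateralOrbit f α) := by
  have hV : ⋃ α ∈ lateralExceptionalSet C, closure (Complex.re '' lateralOrbit f α) =
    postcriticalClosure f C := rfl
  rw [hV]
  have a1 : ∀ᵐ x ∂(volume : Measure ℝ), x ∉ ({0, 1} : Set ℝ) :=
    ((Set.toFinite _).countable.ae_notMem _)
  have a2 := (countable_right_endpoints (survivorSet f C)).ae_notMem volume
  have a3 := (countable_left_endpoints (survivorSet f C)).ae_notMem volume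
  have a4 : ∀ᵐ x ∂(volume : Measure ℝ), ∀ i q : ℕ, 1 ≤ q →
      x ∉ {x ∈ interior (survivorSet f C) | f^[q] (f^[i] x) = f^[i] x} := by
    refine ae_all_iff.2 fun i => ae_all_iff.2 fun q => ?_
    by_cases hq : 1 ≤ q
    · filter_upwards [(hf.countable_preperiodic i hq).ae_notMem volume] with x hx _ using hx
    · exact .of_forall fun x h => (hq h).elim
  -- Rational end points make the family of windows and gaps countable, so that one null set serves
  -- them all.
  have a5 : ∀ᵐ x ∂(volume : Measure ℝ), ∀ (u' u l₁ l₂ v v' : ℚ) (N : ℕ), u' < u → v < v' →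
      (∀ y ∈ Icc (u' : ℝ) v', y ∉ postcriticalClosure f C) → u ≤ l₁ → l₁ < l₂ → l₂ ≤ v →
      x ∉ {x | x ∈ survivorSet f C ∧ IsPiecewiseNegSchwarzian.DomainsShrink f C x ∧
        (∃ᶠ n in atTop, f^[n] x ∈ Icc (u : ℝ) v) ∧ ∀ n ≥ N, f^[n] x ∉ Ioo (l₁ : ℝ) l₂} := by
    simp only [ae_all_iff]
    intro u' u l₁ l₂ v v' N h1 h2 h3 h4 h5 h6
    exact measure_eq_zero_iff_ae_notMem.1 (hf.volume_avoiding_eq_zero (by exact_mod_cast h1)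
      (by exact_mod_cast h2) h3 (by exact_mod_cast h4) (by exact_mod_cast h5)
      (by exact_mod_cast h6) N)
  filter_upwards [a1, a2, a3, a4, a5] with x b1 b2 b3 b4 b5 hx p hp
  by_contra hpV
  obtain ⟨hxpre, hcl⟩ := hp
  have hx01 : x ∈ Ioo (0 : ℝ) 1 := by
    simp only [mem_insert_iff, mem_singleton_iff, not_or] at b1
    exact ⟨hx.1.1.lt_of_ne (Ne.symm b1.1), hx.1.2.lt_of_ne b1.2⟩
  have hxs := hf.mem_survivorSet_of_notMem_preorbit hx01 hxpre
  by_cases hxO : x ∈ interior (survivorSet f C)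
  · obtain ⟨i, j, hij, hsub⟩ := hf.exists_uIcc_subset hxO hpV hcl
    obtain ⟨q, rfl⟩ := Nat.exists_eq_add_of_lt hij
    refine hx.2 (.inl (hf.mem_periodicLikeBasins_of_uIcc_subset hxO (p := q + 1) (by omega) hsub
      fun he => b4 i (2 * (q + 1)) (by omega) ⟨hxO, ?_⟩))
    rw [← Function.iterate_add_apply, add_comm, he]
  · have hsh : IsPiecewiseNegSchwarzian.DomainsShrink f C x :=
      IsPiecewiseNegSchwarzian.domainsShrink (fun h => b2 ⟨hxO, h⟩) fun h => b3 ⟨hxO, h⟩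
    obtain ⟨ε, hε, hball⟩ := Metric.isOpen_iff.1 hf.isClosed_postcriticalClosure.isOpen_compl p hpV
    rw [Real.ball_eq_Ioo] at hball
    obtain ⟨u', hu'1, hu'2⟩ := exists_rat_btwn (show p - ε < p by linarith)
    obtain ⟨u, hu1, hu2⟩ := exists_rat_btwn hu'2
    obtain ⟨v', hv'1, hv'2⟩ := exists_rat_btwn (show p < p + ε by linarith)
    obtain ⟨v, hv1, hv2⟩ := exists_rat_btwn hv'1
    have hfree : ∀ y ∈ Icc (u' : ℝ) v', y ∉ postcriticalClosure f C := fun y hy =>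
      hball ⟨hu'1.trans_le hy.1, hy.2.trans_lt hv'2⟩
    have hfr : ∃ᶠ n in atTop, f^[n] x ∈ Icc (u : ℝ) v := hcl.frequently (Icc_mem_nhds hu2 hv1)
    -- Each neighbourhood of a point of the window contains a rational gap inside the window, which
    -- the orbit cannot eventually avoid.
    have hsubω : Ioo (u : ℝ) v ⊆ omegaSet f C x := by
      refine fun y hy => ⟨hxpre, ?_⟩
      rw [mapClusterPt_iff_frequently]
      intro s hs
      obtain ⟨δ, hδ, hδs⟩ := Metric.mem_nhds_iff.1 hs
      rw [Real.ball_eq_Ioo] at hδs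
      obtain ⟨l₁, h11, h12⟩ := exists_rat_btwn (max_lt hy.1 (show y - δ < y by linarith))
      obtain ⟨l₂, h21, h22⟩ := exists_rat_btwn (lt_min hy.2 (show y < y + δ by linarith))
      rw [max_lt_iff] at h11
      rw [lt_min_iff] at h22
      rw [frequently_atTop]
      intro N
      by_contra! hc
      refine b5 u' u l₁ l₂ v v' N (by exact_mod_cast hu1) (by exact_mod_cast hv2) hfree
        (by exact_mod_cast h11.1.le) (by exact_mod_cast h12.trans h21)
        (by exact_mod_cast h22.1.le) ⟨hxs, hsh, hfr, fun n hn hmem => hc n hn (hδs ?_)⟩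
      exact ⟨h11.2.trans hmem.1, hmem.2.trans h22.2⟩
    exact hx.2 (.inr ⟨hx.1, (nonempty_Ioo.2 (hu2.trans hv1)).mono
      (interior_maximal hsubω isOpen_Ioo)⟩)
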